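/- Let $\eta(\tau)=e^{2\pi i\tau/24}\prod_{n\ge 1}(1-e^{2\pi i n\tau})$ be the Dedekind eta function on the upper half plane $\mathbb H$, and write $\prod_i a_i^{d_i}$ for the $\eta$-quotient $\prod_i\eta(a_i\tau)^{d_i}$ ($a_i$ positive integers, $d_i\in\mathbb Z$; every number written below as the base of a power in the formulas for $y$ and $z$ has this meaning). Then the following identities hold for every $\tau\in\mathbb H$; in particular all denominators that occur in them (also $y+4$ and $y+8$ in (3), and $y+4$ in (7)) have no zeros on $\mathbb H$. (1) $z+16z^{-1}=y$ for $y=\frac{2^{24}}{1^{12}4^{12}}$, $z=\frac{1^4}{4^4}$. (2) $z+9+27z^{-1}=y$ for $y=\frac{3^{12}}{1^69^6}$, $z=\frac{1^3}{9^3}$. (3) For $y=\frac{1^44^2}{2^28^4}$: $z=\frac{y^4}{(y+4)(y+8)^2}$ with $z=\frac{1^{24}}{2^{24}}$, and $z=\frac{y(y+8)}{y+4}$ with $z=\frac{2^{12}}{4^{12}}$. (4) For $y=\frac{1^63^6}{2^66^6}$: $z+729z^{-1}+54=(y+16)^3y^{-2}$ with $z=\frac{1^{12}}{3^{12}}$,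 and $z+729z^{-1}+54=(y+4)^3y^{-1}$ with $z=\frac{2^{12}}{6^{12}}$. (5) For $y=\frac{1^22^2}{3^26^2}$: $z+64z^{-1}=(y^2+27)^2y^{-3}$ with $z=\frac{1^{12}}{2^{12}}$, and $z+64z^{-1}=(y^2+3)^2y^{-1}$ with $z=\frac{3^{12}}{6^{12}}$. (6) For $y=\frac{1^45^4}{2^410^4}$: $z+125z^{-1}+22=(y+4)(1+8y^{-1})^2$ with $z=\frac{1^6}{5^6}$, and $z+125z^{-1}+22=(y+2)^2(1+4y^{-1})$ with $z=\frac{2^6}{10^6}$. (7) For $y=\frac{1^23^2}{4^212^2}$: $z+729z^{-1}+54=\frac{(y+8)^6}{y^4(y+4)}$ with $z=\frac{1^{12}}{3^{12}}$; $z-27z^{-1}=\frac{(y+2)(y-4)(y+8)}{y(y+4)}$ with $z=\frac{2^6}{6^6}$; and $z+729z^{-1}+54=\frac{(y+2)^6}{y(y+4)}$ with $z=\frac{4^{12}}{12^{12}}$. (8) For $y=\frac{1^37^3}{2^314^3}$: $z+49z^{-1}+13=(y+4)^3y^{-2}$ with $z=\frac{1^4}{7^4}$, and $z+49z^{-1}+13=(y+2)^3y^{-1}$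 with $z=\frac{2^4}{14^4}$. (9) For $y=\frac{1^25^2}{3^215^2}$: $z+125z^{-1}+22=(y+9+27y^{-1})^2y^{-1}$ with $z=\frac{1^6}{5^6}$, and $z+125z^{-1}+22=(y+3+3y^{-1})^2y$ with $z=\frac{3^6}{15^6}$. -/

import Mathlib

open UpperHalfPlane

/-- The `η`-quotient `∏ᵢ η(aᵢ τ) ^ dᵢ`, given by the list of pairs `(aᵢ, dᵢ)` of positive integers `aᵢ`
and integer exponents `dᵢ`. Here `η` is the Dedekind eta function
`η(τ) = q ^ (1/24) * ∏ (1 - q ^ n)` with `q ^ (1/24) = exp (2 π i τ / 24)`. -/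
noncomputable def etaQuotient (l : List (ℕ × ℤ)) (τ : ℍ) : ℂ :=
  (l.map fun p => ModularForm.eta ((p.1 : ℂ) * (τ : ℂ)) ^ p.2).prod

/-! Each identity says that some Laurent polynomial F in η-quotients of weight 0 is zero. Multiply F
by a suitable η-quotient g, so that every monomial of g F is invariant under Γ₀(N) and has no pole
at any cusp except infinity. If moreover the q-expansion of g F vanishes through its constant term,
then g F is a modular form of weight 0, hence constant, and its limit at infinity is 0. Since g has
no zeros, F = 0. This is `comb_eq_zero` and `laurent_eq_zero`.

All the hypotheses become finite computations. The function η² transforms by a twelfth root of unity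
whose exponent is the polynomial `psi` (`eta_sq_smul`), so invariance is tested modulo 3 and modulo
4. The orders at the cusps are given by the gcd formula `cuspOrder`. The q-expansions are lists of
integers modulo q^13.

Only η² is controlled, so the exponents must be even. At levels 9 and 14 one generator has odd
exponents. There F₁ is multiplied by F₂, obtained up to sign by changing the sign of that generator.
The product is even in it, hence accessible, and F₁ = 0 follows because F₂ is not identically zero
(`laurent_eq_zero_of_mul`).

The denominators y + 4 and y + 8 have no zeros because they are themselves η-quotients. -/

namespace EtaQuotient

open ModularForm MatrixGroups
open Complex hiding eta I

/-! ### The multiplier of η² on SL(2, ℤ) -/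

/-- The primitive twelfth root of unity `exp (2 π i / 12)`. -/
noncomputable def zeta : ℂ := exp (2 * Real.pi * Complex.I / 12)

lemma zeta_ne_zero : zeta ≠ 0 := exp_ne_zero _

lemma zeta_pow_twelve : zeta ^ 12 = 1 := by
  rw [zeta, ← Complex.exp_nat_mul, ← Complex.exp_two_pi_mul_I]
  congr 1
  push_cast
  ring

lemma zeta_zpow_neg_three : zeta ^ (-3 : ℤ) = -Complex.I := by
  rw [zeta, ← Complex.exp_int_mul, ← Complex.exp_neg_pi_div_two_mul_I]
  congr 1
  push_cast
  ring

/-- By the Chinese remainder theorem an exponent of `zeta` only matters modulo 3 and modulo 4.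
Exhaustive checks then run over 3⁴ and 4⁴ quadruples instead of 12⁴. -/
lemma zeta_zpow_eq_one {n : ℤ} (h3 : (n : ZMod 3) = 0) (h4 : (n : ZMod 4) = 0) : zeta ^ n = 1 := by
  rw [ZMod.intCast_zmod_eq_zero_iff_dvd] at h3 h4
  obtain ⟨k, rfl⟩ : (12 : ℤ) ∣ n := by
    push_cast at h3 h4
    lia
  rw [zpow_mul, show zeta ^ (12 : ℤ) = zeta ^ 12 by norm_cast, zeta_pow_twelve, one_zpow]

lemma zeta_zpow_congr {m n : ℤ} (h3 : (m : ZMod 3) = n) (h4 : (m : ZMod 4) = n) :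
    zeta ^ m = zeta ^ n := by
  have := zeta_zpow_eq_one (n := m - n) (by simp [h3]) (by simp [h4])
  rwa [zpow_sub₀ zeta_ne_zero, div_eq_one_iff_eq (zpow_ne_zero _ zeta_ne_zero)] at this

/-- Modulo 12, this is the isomorphism from the abelianization of `SL(2, ℤ)` to `ZMod 12`. -/
def psi {R : Type*} [CommRing R] (a b c d : R) : R :=
  (1 - c ^ 2) * (b * d + 3 * (c - 1) * d + c + 3) + c * (a + d - 3)

lemma psi_intCast {R : Type*} [CommRing R] (a b c d : ℤ) :
    ((psi a b c d : ℤ) : R) = psi (a : R) b c d := by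
  simp [psi]

/-- Left multiplication by S contributes the factor -i = `zeta ^ (-3)` of η²(-1/τ), and left
multiplication by T the factor `zeta`. These rules and the value 0 at the identity determine the
exponent. -/
lemma psi_S_three : ∀ a b c d : ZMod 3, a * d - b * c = 1 →
    psi (-c) (-d) a b = psi a b c d - 3 := by
  unfold psi; decide

lemma psi_S_four : ∀ a b c d : ZMod 4, a * d - b * c = 1 →
    psi (-c) (-d) a b = psi a b c d - 3 := by
  unfold psi; decide +kernel

lemma psi_T_three : ∀ a b c d : ZMod 3, a * d - b * c = 1 →
    psi (a + c) (b + d) c d = psi a b c d + 1 := by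
  unfold psi; decide

lemma psi_T_four : ∀ a b c d : ZMod 4, a * d - b * c = 1 →
    psi (a + c) (b + d) c d = psi a b c d + 1 := by
  unfold psi; decide +kernel

lemma det_cast (R : Type*) [CommRing R] {a b c d : ℤ} (h : a * d - b * c = 1) :
    (a : R) * d - b * c = 1 := by
  exact_mod_cast congrArg (Int.cast (R := R)) h

lemma zeta_psi_S {a b c d : ℤ} (h : a * d - b * c = 1) :
    zeta ^ psi (-c) (-d) a b = zeta ^ psi a b c d * -Complex.I := by
  rw [← zeta_zpow_neg_three, ← zpow_add₀ zeta_ne_zero]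
  apply zeta_zpow_congr
  · simpa [psi_intCast, sub_eq_add_neg] using psi_S_three a b c d (det_cast _ h)
  · simpa [psi_intCast, sub_eq_add_neg] using psi_S_four a b c d (det_cast _ h)

lemma zeta_psi_T {a b c d : ℤ} (h : a * d - b * c = 1) :
    zeta ^ psi (a + c) (b + d) c d = zeta ^ psi a b c d * zeta := by
  rw [← zpow_add_one₀ zeta_ne_zero]
  apply zeta_zpow_congr
  · simpa [psi_intCast] using psi_T_three a b c d (det_cast _ h)
  · simpa [psi_intCast] using psi_T_four a b c d (det_cast _ h)

lemma eta_sq_add_one (τ : ℍ) : eta ((τ : ℂ) + 1) ^ 2 = zeta * eta τ ^ 2 := by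
  have h1 : Function.Periodic.qParam 1 ((τ : ℂ) + 1) = Function.Periodic.qParam 1 (τ : ℂ) := by
    simp only [Function.Periodic.qParam, ofReal_one, div_one, mul_add, mul_one, Complex.exp_add,
      Complex.exp_two_pi_mul_I]
  have h2 : Function.Periodic.qParam 24 ((τ : ℂ) + 1) ^ 2 =
      zeta * Function.Periodic.qParam 24 (τ : ℂ) ^ 2 := by
    simp only [Function.Periodic.qParam, zeta, ← Complex.exp_nat_mul, ← Complex.exp_add]
    congr 1
    push_cast
    ring
  simp only [eta, eta_q, mul_pow, h1, h2]
  ring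

/-- Squaring removes the square roots from the inversion law of η, so no branch has to be tracked
afterwards. -/
lemma eta_sq_neg_inv (τ : ℍ) : eta (-1 / (τ : ℂ)) ^ 2 = -Complex.I * τ * eta τ ^ 2 := by
  have h := eta_comp_eq_csqrt_I_inv τ.2
  have hs (z : ℂ) (hz : z ≠ 0) : sqrt z ^ 2 = z := by
    rw [sqrt_eq_exp hz, ← Complex.exp_nat_mul]
    rw [show ((2 : ℕ) : ℂ) * (log z / 2) = log z by push_cast; ring, exp_log hz]
  simp only [Function.comp_apply, Pi.smul_apply, Pi.mul_apply, smul_eq_mul] at h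
  rw [UpperHalfPlane.coe] at *
  rw [h, mul_pow, mul_pow, inv_pow, hs _ I_ne_zero, hs _ τ.ne_zero, inv_I]
  ring

lemma den_ne_zero {a b c d : ℤ} (h : a * d - b * c = 1) (τ : ℍ) : (c : ℂ) * τ + d ≠ 0 := by
  let γ : SL(2, ℤ) := ⟨!![a, b; c, d], by simp [Matrix.det_fin_two, h]⟩
  have := UpperHalfPlane.denom_ne_zero (γ : GL (Fin 2) ℝ) τ
  rwa [ModularGroup.denom_apply] at this

/-- The transformation law of `η ^ 2` under a matrix of determinant one. -/
def TransformsBy (a b c d : ℤ) : Prop := ∀ τ : ℍ,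
  eta ((a * τ + b) / (c * τ + d)) ^ 2 = zeta ^ psi a b c d * (c * τ + d) * eta τ ^ 2

lemma smul_coe (γ : SL(2, ℤ)) (τ : ℍ) :
    ((γ • τ : ℍ) : ℂ) = ((γ 0 0 : ℤ) * τ + (γ 0 1 : ℤ)) / ((γ 1 0 : ℤ) * τ + (γ 1 1 : ℤ)) := by
  simp only [coe_specialLinearGroup_apply, algebraMap_int_eq, eq_intCast, ofReal_intCast]

lemma det_eq (γ : SL(2, ℤ)) : γ 0 0 * γ 1 1 - γ 0 1 * γ 1 0 = 1 := by
  rw [← Matrix.det_fin_two, γ.det_coe]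

lemma exists_coe_eq {a b c d : ℤ} (h : a * d - b * c = 1) (τ : ℍ) :
    ∃ w : ℍ, (w : ℂ) = (a * τ + b) / (c * τ + d) :=
  let γ : SL(2, ℤ) := ⟨!![a, b; c, d], by simp [Matrix.det_fin_two, h]⟩
  ⟨γ • τ, smul_coe γ τ⟩

lemma TransformsBy.S {a b c d : ℤ} (h : a * d - b * c = 1) (H : TransformsBy a b c d) :
    TransformsBy (-c) (-d) a b := by
  intro τ
  obtain ⟨w, hw⟩ := exists_coe_eq h τ
  have h1 := eta_sq_neg_inv w
  rw [hw, H τ] at h1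
  have hd := den_ne_zero h τ
  have hn := den_ne_zero (a := -c) (b := -d) (c := a) (d := b) (by linarith) τ
  have : ((-c : ℤ) * (τ : ℂ) + (-d : ℤ)) / (a * τ + b) = -1 / ((a * τ + b) / (c * τ + d)) := by
    push_cast; field_simp; ring
  rw [this, h1, zeta_psi_S h, ← mul_div_cancel_left₀ ((a : ℂ) * τ + b) hd]
  field_simp

lemma TransformsBy.T {a b c d : ℤ} (h : a * d - b * c = 1) (H : TransformsBy a b c d) :
    TransformsBy (a + c) (b + d) c d := by
  intro τ
  obtain ⟨w, hw⟩ := exists_coe_eq h τ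
  have h1 := eta_sq_add_one w
  rw [hw, H τ] at h1
  have hd := den_ne_zero h τ
  have : ((a + c : ℤ) * (τ : ℂ) + (b + d : ℤ)) / (c * τ + d) = (a * τ + b) / (c * τ + d) + 1 := by
    push_cast; field_simp; ring
  rw [this, h1, zeta_psi_T h]
  ring

lemma TransformsBy.T_inv {a b c d : ℤ} (h : a * d - b * c = 1) (H : TransformsBy a b c d) :
    TransformsBy (a - c) (b - d) c d := by
  intro τ
  have h' : (a - c) * d - (b - d) * c = 1 := by linarith
  obtain ⟨w, hw⟩ := exists_coe_eq h' τ
  have h1 := eta_sq_add_one w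
  have hd := den_ne_zero h τ
  have : (w : ℂ) + 1 = (a * τ + b) / (c * τ + d) := by
    rw [hw]; push_cast; field_simp; ring
  rw [this, H τ, hw] at h1
  have h2 := zeta_psi_T h'
  simp only [sub_add_cancel] at h2
  rw [h2] at h1
  apply mul_left_cancel₀ zeta_ne_zero
  rw [← h1]
  ring

/-- Induction on a word in S, T and their inverses, the law being stable under left multiplication
by each letter. -/
lemma transformsBy (γ : SL(2, ℤ)) : TransformsBy (γ 0 0) (γ 0 1) (γ 1 0) (γ 1 1) := by
  have : γ ∈ Subgroup.closure {ModularGroup.S, ModularGroup.T} := by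
    simp [SpecialLinearGroup.SL2Z_generators]
  induction this using Subgroup.closure_induction_left with
  | one => intro τ; simp [psi]
  | mul_left x hx γ _ ih =>
    rcases hx with rfl | rfl
    · have h := ih.S (det_eq γ)
      simp only [Matrix.SpecialLinearGroup.coe_mul, ModularGroup.coe_S, Matrix.mul_apply,
        Fin.sum_univ_two]
      simpa using h
    · have h := ih.T (det_eq γ)
      simp only [Matrix.SpecialLinearGroup.coe_mul, ModularGroup.coe_T, Matrix.mul_apply,
        Fin.sum_univ_two]
      simpa using h
  | inv_mul_cancel x hx γ _ ih =>
    have h := det_eq γ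
    rcases hx with rfl | rfl
    -- S has order 4, so its inverse is S³.
    · have h' := ((ih.S h).S (by linarith)).S (by linarith)
      simp only [Matrix.SpecialLinearGroup.coe_mul, Matrix.SpecialLinearGroup.coe_inv,
        ModularGroup.coe_S, Matrix.mul_apply, Fin.sum_univ_two, Matrix.adjugate_fin_two]
      simpa using h'
    · have h' := ih.T_inv h
      simp only [Matrix.SpecialLinearGroup.coe_mul, Matrix.SpecialLinearGroup.coe_inv,
        ModularGroup.coe_T, Matrix.mul_apply, Fin.sum_univ_two, Matrix.adjugate_fin_two]
      simpa [sub_eq_add_neg] using h'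

theorem eta_sq_smul {a b c d : ℤ} (h : a * d - b * c = 1) (τ : ℍ) :
    eta ((a * τ + b) / (c * τ + d)) ^ 2 = zeta ^ psi a b c d * (c * τ + d) * eta τ ^ 2 :=
  transformsBy (⟨!![a, b; c, d], by simp [Matrix.det_fin_two, h]⟩ : SL(2, ℤ)) τ

end EtaQuotient

/-! ### Invariance under Γ₀(N) and orders at the cusps -/

namespace EtaQuotient

open ModularForm MatrixGroups Filter Asymptotics Topology
open Complex hiding eta I

/-- The quotient `∏ᵢ η(aᵢ τ) ^ (2 dᵢ)`. -/
noncomputable def etaSq (l : List (ℕ × ℤ)) (τ : ℍ) : ℂ :=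
  (l.map fun p => (eta ((p.1 : ℂ) * (τ : ℂ)) ^ 2) ^ p.2).prod

@[simp] lemma etaSq_nil (τ : ℍ) : etaSq [] τ = 1 := rfl

@[simp] lemma etaSq_cons (p : ℕ × ℤ) (l : List (ℕ × ℤ)) (τ : ℍ) :
    etaSq (p :: l) τ = (eta ((p.1 : ℂ) * (τ : ℂ)) ^ 2) ^ p.2 * etaSq l τ := rfl

@[simp] lemma etaQuotient_nil (τ : ℍ) : etaQuotient [] τ = 1 := rfl

@[simp] lemma etaQuotient_cons (p : ℕ × ℤ) (l : List (ℕ × ℤ)) (τ : ℍ) :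
    etaQuotient (p :: l) τ = eta ((p.1 : ℂ) * (τ : ℂ)) ^ p.2 * etaQuotient l τ := rfl

/-- Division of all exponents by two. -/
def halve (l : List (ℕ × ℤ)) : List (ℕ × ℤ) := l.map fun p => (p.1, p.2 / 2)

lemma etaSq_halve {l : List (ℕ × ℤ)} (hl : ∀ p ∈ l, 2 ∣ p.2) (τ : ℍ) :
    etaSq (halve l) τ = etaQuotient l τ := by
  induction l with
  | nil => rfl
  | cons p l ih =>
    obtain ⟨k, hk⟩ := hl p (by simp)
    have hk' : p.2 / 2 = k := by lia
    have := ih fun p hp => hl p (by simp [hp])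
    simp only [halve, List.map_cons, etaSq_cons, etaQuotient_cons] at this ⊢
    rw [this, hk', hk, zpow_mul]
    norm_cast

/-- The sum of the exponents. -/
def weight (l : List (ℕ × ℤ)) : ℤ := (l.map Prod.snd).sum

/-- The exponent of `zeta` in the multiplier of `etaSq l` at `!![a, b; N * c, d]`. -/
def phase {R : Type*} [CommRing R] (N : ℕ) (l : List (ℕ × ℤ)) (a b c d : R) : R :=
  (l.map fun p => (p.2 : R) * psi a ((p.1 : R) * b) (((N / p.1 : ℕ) : R) * c) d).sum

lemma phase_intCast {R : Type*} [CommRing R] (N : ℕ) (l : List (ℕ × ℤ)) (a b c d : ℤ) :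
    ((phase N l a b c d : ℤ) : R) = phase N l (a : R) b c d := by
  induction l with
  | nil => simp [phase]
  | cons p l ih =>
    simp only [phase, List.map_cons, List.sum_cons, Int.cast_add] at ih ⊢
    rw [ih]
    simp only [Int.cast_id, Int.cast_mul, psi_intCast, Int.cast_natCast]

lemma exists_smul_eq {δ : ℕ} (hδ : 0 < δ) (τ : ℍ) : ∃ w : ℍ, (w : ℂ) = δ * τ :=
  ⟨⟨δ * τ, by
    have := τ.im_pos
    simp only [mul_im, natCast_re, natCast_im, zero_mul, add_zero]
    positivity⟩, rfl⟩

/-- For δ dividing N, δ times the image of τ under (a, b; Nc, d) is the image of δτ under (a, δb;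
(N/δ)c, d), again of determinant one. -/
lemma etaSq_transform {N : ℕ} (hN : 0 < N) {a b c d : ℤ} (h : a * d - b * (N * c) = 1)
    {l : List (ℕ × ℤ)} (hl : ∀ p ∈ l, p.1 ∣ N) (τ w : ℍ)
    (hw : (w : ℂ) = (a * τ + b) / (N * c * τ + d)) :
    etaSq l w = zeta ^ phase N l a b c d * (N * c * τ + d) ^ weight l * etaSq l τ := by
  have hd := den_ne_zero h τ
  push_cast at hd
  induction l with
  | nil => simp [phase, weight]
  | cons p l ih =>
    have hp := hl p (by simp)
    have hp0 := Nat.pos_of_dvd_of_pos hp hN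
    obtain ⟨k, hk⟩ := hp
    obtain ⟨v, hv⟩ := exists_smul_eq hp0 τ
    have hNk : N / p.1 = k := by rw [hk, Nat.mul_div_cancel_left _ hp0]
    have h2 := eta_sq_smul (a := a) (b := p.1 * b) (c := k * c) (d := d)
      (by rw [← h, hk]; push_cast; ring) v
    have e1 : ((k * c : ℤ) : ℂ) * v + d = N * c * τ + d := by
      rw [hv, hk]; push_cast; ring
    have e2 : ((p.1 : ℂ) * w) = (a * v + (p.1 * b : ℤ)) / ((k * c : ℤ) * v + d) := by
      rw [e1, hw, hv]; push_cast; ring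
    rw [etaSq_cons, etaSq_cons, ih fun p hp => hl p (by simp [hp]), e2, h2, e1, hv]
    simp only [phase, weight, List.map_cons, List.sum_cons, hNk]
    rw [zpow_add₀ zeta_ne_zero, zpow_add₀ hd, mul_zpow, mul_zpow, ← zpow_mul,
      mul_comm (psi _ _ _ _), Int.cast_id]
    ring

/-- A criterion for `etaSq l` to be invariant under `Γ₀(N)`. -/
def Invariant (N : ℕ) (l : List (ℕ × ℤ)) : Prop :=
  weight l = 0 ∧ (∀ p ∈ l, p.1 ∣ N) ∧
  (∀ a b c d : ZMod 3, a * d - b * (N * c) = 1 → phase N l a b c d = 0) ∧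
  (∀ a b c d : ZMod 4, a * d - b * (N * c) = 1 → phase N l a b c d = 0)

instance (N : ℕ) (l : List (ℕ × ℤ)) : Decidable (Invariant N l) := by
  unfold Invariant; infer_instance

lemma Invariant.smul {N : ℕ} (hN : 0 < N) {l : List (ℕ × ℤ)} (hl : Invariant N l) {γ : SL(2, ℤ)}
    (hγ : (N : ℤ) ∣ γ 1 0) (τ : ℍ) : etaSq l (γ • τ) = etaSq l τ := by
  obtain ⟨hw, hd, h3, h4⟩ := hl
  obtain ⟨c, hc⟩ := hγ
  have h := det_eq γ
  rw [hc] at h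
  rw [etaSq_transform hN h hd τ (γ • τ) (by rw [smul_coe, hc]; push_cast; rfl), hw,
    zeta_zpow_eq_one]
  · simp
  · rw [phase_intCast]
    exact h3 _ _ _ _ (by simpa using det_cast (ZMod 3) h)
  · rw [phase_intCast]
    exact h4 _ _ _ _ (by simpa using det_cast (ZMod 4) h)

lemma norm_zeta : ‖zeta‖ = 1 := by
  rw [zeta, show 2 * (Real.pi : ℂ) * Complex.I / 12 = ((2 * Real.pi / 12 : ℝ) : ℂ) * Complex.I by
    push_cast; ring, norm_exp_ofReal_mul_I]

/-- The root of unity has norm one, and the automorphy factor of |η|⁴ cancels that of the imaginary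
part. -/
lemma norm_eta_smul (γ : SL(2, ℤ)) (τ : ℍ) :
    ‖eta (γ • τ : ℍ)‖ ^ 4 * (γ • τ).im = ‖eta τ‖ ^ 4 * τ.im := by
  have h := congrArg (fun z => ‖z‖ ^ 2) (eta_sq_smul (det_eq γ) τ)
  rw [← smul_coe] at h
  simp only [norm_mul, norm_pow, norm_zpow, norm_zeta, one_zpow, one_mul, mul_pow, ← pow_mul] at h
  rw [h, ModularGroup.im_smul_eq_div_normSq, ModularGroup.denom_apply, ← Complex.normSq_eq_norm_sq]
  have := den_ne_zero (det_eq γ) τ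
  have : Complex.normSq ((γ 1 0 : ℤ) * τ + (γ 1 1 : ℤ)) ≠ 0 := by simpa using this
  field_simp

/-- Hermite normal form: diag(δ, 1) γ = γ' (A, B; 0, D) with A = gcd(c, δ) and AD = δ. It moves the
behaviour of η(δ ·) at the cusp γ∞ to that of η at infinity. -/
lemma exists_hermite (γ : SL(2, ℤ)) {δ : ℕ} (hδ : 0 < δ) :
    ∃ (γ' : SL(2, ℤ)) (D : ℕ) (B : ℤ), Int.gcd (γ 1 0) δ * D = δ ∧
      ∀ τ w : ℍ, (w : ℂ) = (Int.gcd (γ 1 0) δ * τ + B) / D → (δ : ℂ) * (γ • τ : ℍ) = (γ' • w : ℍ) := by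
  set a := γ 0 0
  set b := γ 0 1
  set c := γ 1 0
  set d := γ 1 1
  have h : a * d - b * c = 1 := det_eq γ
  set A := Int.gcd c δ
  have hA : 0 < A := Int.gcd_pos_of_ne_zero_right _ (by lia)
  obtain ⟨D, hD⟩ : A ∣ δ := by exact_mod_cast Int.gcd_dvd_right c (δ : ℤ)
  obtain ⟨C, hC⟩ : (A : ℤ) ∣ c := Int.gcd_dvd_left c (δ : ℤ)
  have hD0 : 0 < D := by
    rcases Nat.eq_zero_or_pos D with rfl | h
    · simp [hD] at hδ
    · exact h
  have hcop : IsCoprime (D : ℤ) C := by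
    have hbez := Int.gcd_eq_gcd_ab c δ
    refine ⟨c.gcdB δ, c.gcdA δ, ?_⟩
    have hA' : (A : ℤ) ≠ 0 := by lia
    apply mul_left_cancel₀ hA'
    have hδ' : (δ : ℤ) = A * D := by exact_mod_cast hD
    change (A : ℤ) = _ at hbez
    calc (A : ℤ) * (c.gcdB δ * D + c.gcdA δ * C)
        = (A * C) * c.gcdA δ + (A * D) * c.gcdB δ := by ring
      _ = A * 1 := by rw [← hC, ← hδ', mul_one, hbez]
  have hcop2 : IsCoprime a C := ⟨d, -(b * A), by rw [hC] at h; linarith⟩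
  obtain ⟨y, x, hxy⟩ := hcop2.mul_left hcop
  let γ' : SL(2, ℤ) := ⟨!![a * D, -x; C, y], by rw [Matrix.det_fin_two_of]; linarith⟩
  -- B is the upper right entry of γ'⁻¹ diag(δ, 1) γ, where γ'⁻¹ has first row (y, x).
  refine ⟨γ', D, y * δ * b + x * d, hD.symm, fun τ w hw => ?_⟩
  have hn := den_ne_zero h τ
  have e : (D : ℂ) ≠ 0 := by exact_mod_cast hD0.ne'
  have hδ' : (δ : ℂ) = A * D := by exact_mod_cast hD
  have hC' : (c : ℂ) = A * C := by exact_mod_cast hC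
  have hxy' : (y : ℂ) * (a * D) + x * C = 1 := by exact_mod_cast hxy
  have h' := det_cast ℂ h
  have hw' : (D : ℂ) * w = A * τ + y * δ * b + x * d := by
    rw [hw]; push_cast; field_simp; ring
  have e1 : ((a * D : ℤ) : ℂ) * w + (-x : ℤ) = A * (a * τ + b) := by
    push_cast
    linear_combination (a : ℂ) * hw' + (x : ℂ) * h' + (a * y * b : ℂ) * hδ' + (x * b : ℂ) * hC' +
      (b * A : ℂ) * hxy'
  have e2 : (C : ℂ) * w + y = (c * τ + d) / D := by
    rw [eq_div_iff e]
    linear_combination (C : ℂ) * hw' + (C * y * b : ℂ) * hδ' - (τ + y * D * b : ℂ) * hC' +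
      (d : ℂ) * hxy' - (y * D : ℂ) * h'
  have h1 := smul_coe γ τ
  have h2 := smul_coe γ' w
  change ((γ • τ : ℍ) : ℂ) = (a * τ + b) / (c * τ + d) at h1
  change ((γ' • w : ℍ) : ℂ) = (((a * D : ℤ) : ℂ) * w + (-x : ℤ)) / ((C : ℂ) * w + y) at h2
  rw [h1, h2, e1, e2, hδ']
  field_simp

lemma differentiableAt_eta_smul {δ : ℕ} (hδ : 0 < δ) (τ : ℍ) :
    DifferentiableAt ℂ (fun z : ℂ => eta (δ * z)) τ := by
  obtain ⟨w, hw⟩ := exists_smul_eq hδ τ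
  refine DifferentiableAt.comp (g := eta) (f := fun z : ℂ => δ * z) _ ?_ (by fun_prop)
  rw [← hw]
  exact differentiableAt_eta_of_mem_upperHalfPlaneSet w.2

lemma eta_smul_ne_zero {δ : ℕ} (hδ : 0 < δ) (τ : ℍ) : eta (δ * τ) ≠ 0 := by
  obtain ⟨w, hw⟩ := exists_smul_eq hδ τ
  rw [← hw]
  exact eta_ne_zero w.2

/-- The Euler product `∏ (1 - q ^ n)`. -/
noncomputable def euler (q : ℂ) : ℂ := ∏' n : ℕ, (1 - q ^ (n + 1))

lemma tendsto_euler : Tendsto euler (𝓝 0) (𝓝 1) := by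
  have : ContinuousAt euler 0 :=
    (differentiableOn_tprod_one_sub_pow.differentiableAt
      (Metric.ball_mem_nhds (0 : ℂ) one_pos)).continuousAt
  simpa [ContinuousAt, euler] using this

lemma eta_eq (z : ℂ) : eta z = cexp (2 * Real.pi * Complex.I * z / 24) *
    euler (cexp (2 * Real.pi * Complex.I * z)) := by
  simp [eta, euler, Function.Periodic.qParam, eta_q]

lemma tendsto_q : Tendsto (fun τ : ℍ => cexp (2 * Real.pi * Complex.I * τ)) atImInfty (𝓝 0) := by
  simpa [Function.Periodic.qParam] using UpperHalfPlane.qParam_tendsto_atImInfty one_pos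

lemma norm_eta_isTheta :
    (fun τ : ℍ => ‖eta τ‖ ^ 4) =Θ[atImInfty] fun τ : ℍ => Real.exp (-(Real.pi / 3) * τ.im) := by
  have h1 : Tendsto (fun τ : ℍ => ‖euler (cexp (2 * Real.pi * Complex.I * τ))‖ ^ 4)
      atImInfty (𝓝 (‖(1 : ℂ)‖ ^ 4)) := ((tendsto_euler.comp tendsto_q).norm).pow 4
  refine (isTheta_of_div_tendsto_nhds_ne_zero (c := 1) ?_ one_ne_zero).symm
  rw [norm_one, one_pow] at h1
  refine h1.congr fun τ => ?_
  rw [eq_div_iff (Real.exp_pos _).ne', eta_eq τ, norm_mul, mul_pow, Complex.norm_exp,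
    ← Real.exp_nat_mul, mul_comm]
  congr 2
  simp
  ring

/-- After the normal form, η is evaluated at (Aτ + B)/D, of imaginary part (A/D) Im τ, and A/D =
A²/δ is the exponential rate. -/
lemma norm_eta_smul_isTheta (γ : SL(2, ℤ)) {δ : ℕ} (hδ : 0 < δ) :
    (fun τ : ℍ => ‖eta (δ * (γ • τ : ℍ))‖ ^ 4 * (γ • τ).im) =Θ[atImInfty]
      fun τ : ℍ => Real.exp (-(Real.pi / 3) * ((Int.gcd (γ 1 0) δ : ℝ) ^ 2 / δ) * τ.im) * τ.im := by
  obtain ⟨γ', D, B, hD, H⟩ := exists_hermite γ hδ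
  set A := Int.gcd (γ 1 0) δ
  have hA : 0 < A := Nat.pos_of_ne_zero fun h => by simp [h] at hD; lia
  have hD0 : 0 < D := Nat.pos_of_ne_zero fun h => by simp [h] at hD; lia
  have hAR : (0 : ℝ) < A := by exact_mod_cast hA
  have hDR : (0 : ℝ) < D := by exact_mod_cast hD0
  have hδR : (0 : ℝ) < δ := by exact_mod_cast hδ
  have him (τ : ℍ) : (((A : ℂ) * τ + B) / D).im = A / D * τ.im := by
    have : ((A : ℂ) * τ + B) / D = ((A / D : ℝ) : ℂ) * τ + ((B / D : ℝ) : ℂ) := by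
      push_cast; ring
    rw [this]
    simp only [Complex.add_im, Complex.im_ofReal_mul, Complex.ofReal_im,
      add_zero, coe_im]
  let w (τ : ℍ) : ℍ := ⟨((A : ℂ) * τ + B) / D, by
    have := τ.im_pos
    rw [him]; positivity⟩
  have hw : Tendsto w atImInfty atImInfty := by
    rw [atImInfty, tendsto_comap_iff]
    refine Tendsto.congr (fun τ => (him τ).symm) ?_
    exact tendsto_comap.const_mul_atTop (by positivity)
  have key (τ : ℍ) : ‖eta (δ * (γ • τ : ℍ))‖ ^ 4 * (γ • τ).im =
      (A / D / δ : ℝ) * (‖eta (w τ)‖ ^ 4 * τ.im) := by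
    have h1 := norm_eta_smul γ' (w τ)
    have h2 := H τ (w τ) rfl
    have h3 : (γ' • w τ).im = δ * (γ • τ).im := by
      have := congrArg Complex.im h2
      rw [← coe_im, ← this]
      simp
    have h4 : (w τ).im = A / D * τ.im := him τ
    rw [← h2, h3, h4] at h1
    field_simp at h1 ⊢
    linarith
  simp only [key]
  have hAD : ((A : ℝ) / D / δ) ≠ 0 := by positivity
  rw [isTheta_const_mul_left hAD]
  refine IsTheta.mul ?_ (isTheta_refl _ _)
  have h5 := norm_eta_isTheta
  have h6 : (fun τ => ‖eta (w τ)‖ ^ 4) =Θ[atImInfty]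
      fun τ : ℍ => Real.exp (-(Real.pi / 3) * (w τ).im) :=
    ⟨h5.1.comp_tendsto hw, h5.2.comp_tendsto hw⟩
  refine h6.trans (EventuallyEq.isTheta (.of_forall fun τ => ?_))
  have h4 : (w τ).im = A / D * τ.im := him τ
  have hδ' : (δ : ℝ) = A * D := by exact_mod_cast hD.symm
  simp only [h4, hδ']
  congr 1
  field_simp

/-- The order of vanishing of `etaSq l` at the cusps `a / c`, up to a positive factor. -/
def cuspOrder (N : ℕ) (l : List (ℕ × ℤ)) (c : ℤ) : ℤ :=
  (l.map fun p => p.2 * ((Int.gcd c p.1 ^ 2 * (N / p.1) : ℕ) : ℤ)).sum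

/-- Ligozat's formula for the order at a cusp. The power of the imaginary part lets the factors be
multiplied one at a time, and disappears in weight 0. -/
lemma norm_etaSq_smul_isTheta {N : ℕ} (hN : 0 < N) {l : List (ℕ × ℤ)} (hl : ∀ p ∈ l, p.1 ∣ N)
    (γ : SL(2, ℤ)) :
    (fun τ : ℍ => ‖etaSq l (γ • τ)‖ ^ 2 * (γ • τ).im ^ weight l) =Θ[atImInfty]
      fun τ : ℍ => Real.exp (-(Real.pi / 3) * (cuspOrder N l (γ 1 0) / N) * τ.im) *
        τ.im ^ weight l := by
  induction l with
  | nil => simp [weight, cuspOrder]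
  | cons p l ih =>
    have hp := hl p (by simp)
    have hp0 := Nat.pos_of_dvd_of_pos hp hN
    obtain ⟨k, hk⟩ := hp
    have hNk : N / p.1 = k := by rw [hk, Nat.mul_div_cancel_left _ hp0]
    have hk0 : 0 < k := Nat.pos_of_ne_zero fun h => by simp [h] at hk; lia
    have h1 := ((norm_eta_smul_isTheta γ hp0).zpow p.2).mul (ih fun p hp => hl p (by simp [hp]))
    refine (EventuallyEq.isTheta (.of_forall fun τ => ?_)).trans
      (h1.trans (EventuallyEq.isTheta (.of_forall fun τ => ?_)))
    · have := (γ • τ).im_ne_zero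
      simp only [etaSq_cons, weight, List.map_cons, List.sum_cons, zpow_add₀ this, norm_mul,
        norm_zpow, mul_zpow, ← zpow_natCast, ← zpow_mul]
      push_cast
      rw [show (2 : ℤ) * p.2 * 2 = 4 * p.2 by ring]
      ring
    · have := τ.im_ne_zero
      have hpR : (p.1 : ℝ) ≠ 0 := by exact_mod_cast hp0.ne'
      have hkR : (k : ℝ) ≠ 0 := by exact_mod_cast hk0.ne'
      simp only [weight, List.map_cons, List.sum_cons, zpow_add₀ this, mul_zpow, cuspOrder, hNk,
        ← Real.rpow_intCast (Real.exp _), ← Real.exp_mul]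
      rw [mul_mul_mul_comm, ← Real.exp_add]
      congr 2
      rw [hk]
      push_cast
      field_simp
      ring

lemma isBoundedAtImInfty_etaSq_smul {N : ℕ} (hN : 0 < N) {l : List (ℕ × ℤ)}
    (hl : ∀ p ∈ l, p.1 ∣ N) (hw : weight l = 0) {γ : SL(2, ℤ)}
    (hc : 0 ≤ cuspOrder N l (γ 1 0)) : IsBoundedAtImInfty fun τ => etaSq l (γ • τ) := by
  have h := norm_etaSq_smul_isTheta hN hl γ
  simp only [hw, zpow_zero, mul_one] at h
  have h1 : (fun τ : ℍ => Real.exp (-(Real.pi / 3) * (cuspOrder N l (γ 1 0) / N) * τ.im))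
      =O[atImInfty] fun _ => (1 : ℝ) := by
    refine .of_bound 1 (.of_forall fun τ => ?_)
    have := τ.im_pos
    have hc' : (0 : ℝ) ≤ cuspOrder N l (γ 1 0) := by exact_mod_cast hc
    rw [Real.norm_of_nonneg (Real.exp_pos _).le, norm_one, mul_one, Real.exp_le_one_iff]
    have : 0 ≤ Real.pi / 3 * (cuspOrder N l (γ 1 0) / N) * τ.im := by positivity
    linarith
  have h2 := h.1.trans h1
  exact (IsBigO.of_pow (f := fun τ => ‖etaSq l (γ • τ)‖) (g := fun _ => (1 : ℝ)) two_ne_zero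
    (h2.congr_right fun _ => by simp)).of_norm_left

end EtaQuotient

/-! ### Computable truncated q-expansions -/

namespace EtaQuotient

open ModularForm MatrixGroups Filter Asymptotics Topology
open Complex hiding eta I

/-- Sum of polynomials given by their lists of coefficients. -/
def addL : List ℤ → List ℤ → List ℤ
  | [], r => r
  | a :: p, [] => a :: p
  | a :: p, b :: r => (a + b) :: addL p r

/-- Product of polynomials given by their lists of coefficients. -/
def mulL : List ℤ → List ℤ → List ℤ
  | [], _ => []
  | a :: p, r => addL (r.map (a * ·)) (0 :: mulL p r)

/-- Product modulo `X ^ K`. -/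
def mulT (K : ℕ) (p r : List ℤ) : List ℤ := (mulL p r).take K

/-- Power modulo `X ^ K`. -/
def powT (K : ℕ) (p : List ℤ) : ℕ → List ℤ
  | 0 => [1]
  | n + 1 => mulT K p (powT K p n)

/-- Substitution of `X ^ δ` for `X`. -/
def dilate (δ : ℕ) (p : List ℤ) : List ℤ := p.flatMap fun a => a :: List.replicate (δ - 1) 0

/-- The Euler product modulo `X ^ K`. -/
def eulerL (K : ℕ) : ℕ → List ℤ
  | 0 => [1]
  | n + 1 => mulT K (eulerL K n) (1 :: (List.replicate n 0 ++ [-1]))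


/-- Evaluation of the polynomial with the given list of coefficients. -/
noncomputable def ev (p : List ℤ) (q : ℂ) : ℂ := p.foldr (fun a x => a + q * x) 0

@[simp] lemma ev_nil (q : ℂ) : ev [] q = 0 := rfl

@[simp] lemma ev_cons (a : ℤ) (p : List ℤ) (q : ℂ) : ev (a :: p) q = a + q * ev p q := rfl

lemma ev_addL (p r : List ℤ) (q : ℂ) : ev (addL p r) q = ev p q + ev r q := by
  induction p generalizing r with
  | nil => simp [addL]
  | cons a p ih =>
    cases r with
    | nil => simp [addL]
    | cons b r => simp [addL, ih]; ring

lemma ev_map_mul (c : ℤ) (p : List ℤ) (q : ℂ) : ev (p.map (c * ·)) q = c * ev p q := by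
  induction p with
  | nil => simp
  | cons a p ih => simp [ih]; ring

lemma ev_mulL (p r : List ℤ) (q : ℂ) : ev (mulL p r) q = ev p q * ev r q := by
  induction p with
  | nil => simp [mulL]
  | cons a p ih => simp [mulL, ev_addL, ev_map_mul, ih]; ring

lemma ev_replicate_append (n : ℕ) (p : List ℤ) (q : ℂ) :
    ev (List.replicate n 0 ++ p) q = q ^ n * ev p q := by
  induction n with
  | zero => simp
  | succ n ih => simp [List.replicate_succ, ih]; ring

lemma ev_dilate {δ : ℕ} (hδ : 0 < δ) (p : List ℤ) (q : ℂ) : ev (dilate δ p) q = ev p (q ^ δ) := by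
  obtain ⟨n, rfl⟩ := Nat.exists_eq_add_of_lt hδ
  induction p with
  | nil => simp [dilate]
  | cons a p ih =>
    simp only [dilate, List.flatMap_cons, List.cons_append, ev_cons, ev_replicate_append] at ih ⊢
    rw [ih]
    simp only [zero_add, Nat.add_sub_cancel]
    ring

lemma ev_eq_take_add_drop (K : ℕ) (p : List ℤ) (q : ℂ) :
    ev p q = ev (p.take K) q + q ^ K * ev (p.drop K) q := by
  induction K generalizing p with
  | zero => simp
  | succ K ih =>
    cases p with
    | nil => simp
    | cons a p =>
      rw [List.take_succ_cons, List.drop_succ_cons, ev_cons, ev_cons, ih p]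
      ring

lemma continuous_ev (p : List ℤ) : Continuous (ev p) := by
  induction p with
  | nil => exact continuous_const
  | cons a p ih => exact continuous_const.add (continuous_id.mul ih)

lemma ev_isBigO_one (p : List ℤ) : ev p =O[𝓝 0] fun _ => (1 : ℂ) :=
  (continuous_ev p).continuousAt.isBigO_one ℂ

/-- `f` agrees with the polynomial `p` up to `O(q ^ K)` at zero. -/
def Approx (K : ℕ) (f : ℂ → ℂ) (p : List ℤ) : Prop :=
  (fun q => f q - ev p q) =O[𝓝 0] fun q => q ^ K

lemma pow_isBigO_one (K : ℕ) : (fun q : ℂ => q ^ K) =O[𝓝 0] fun _ => (1 : ℂ) :=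
  (continuous_pow K).continuousAt.isBigO_one ℂ

lemma Approx.isBigO_one {K : ℕ} {f : ℂ → ℂ} {p : List ℤ} (h : Approx K f p) :
    f =O[𝓝 0] fun _ => (1 : ℂ) :=
  ((h.trans (pow_isBigO_one K)).add (ev_isBigO_one p)).congr_left fun _ => by ring

lemma Approx.of_ev {K : ℕ} {f : ℂ → ℂ} {p : List ℤ} (h : ∀ q, f q = ev p q) : Approx K f p := by
  simpa [Approx, h] using isBigO_zero _ _

lemma Approx.one (K : ℕ) : Approx K (fun _ => 1) [1] := .of_ev fun q => by simp

lemma mul_ev_isBigO (K : ℕ) (p : List ℤ) : (fun q => q ^ K * ev p q) =O[𝓝 0] fun q => q ^ K := by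
  simpa using (isBigO_refl (fun q : ℂ => q ^ K) (𝓝 0)).mul (ev_isBigO_one p)

lemma Approx.take {K : ℕ} {f : ℂ → ℂ} {p : List ℤ} (h : Approx K f p) :
    Approx K f (p.take K) :=
  (h.add (mul_ev_isBigO K (p.drop K))).congr_left fun q => by
    rw [ev_eq_take_add_drop K p q]; ring

lemma Approx.mul {K : ℕ} {f g : ℂ → ℂ} {p r : List ℤ} (hf : Approx K f p) (hg : Approx K g r) :
    Approx K (fun q => f q * g q) (mulT K p r) := by
  apply Approx.take
  have h1 := IsBigO.mul hf hg.isBigO_one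
  have h2 := (ev_isBigO_one p).mul hg
  simp only [mul_one, one_mul] at h1 h2
  exact (h1.add h2).congr_left fun q => by rw [ev_mulL]; ring

lemma Approx.pow {K : ℕ} {f : ℂ → ℂ} {p : List ℤ} (hf : Approx K f p) (n : ℕ) :
    Approx K (fun q => f q ^ n) (powT K p n) := by
  induction n with
  | zero => simpa [powT] using Approx.one K
  | succ n ih =>
    simp only [pow_succ']
    exact hf.mul ih

lemma Approx.add {K : ℕ} {f g : ℂ → ℂ} {p r : List ℤ} (hf : Approx K f p) (hg : Approx K g r) :
    Approx K (fun q => f q + g q) (addL p r) :=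
  (IsBigO.add hf hg).congr_left fun q => by rw [ev_addL]; ring

lemma Approx.const_mul {K : ℕ} {f : ℂ → ℂ} {p : List ℤ} (hf : Approx K f p) (c : ℤ) :
    Approx K (fun q => c * f q) (p.map (c * ·)) :=
  (hf.const_mul_left (c : ℂ)).congr_left fun q => by rw [ev_map_mul]; ring

lemma Approx.shift {K : ℕ} {f : ℂ → ℂ} {p : List ℤ} (hf : Approx K f p) (n : ℕ) :
    Approx K (fun q => q ^ n * f q) (List.replicate n 0 ++ p) := by
  have := (pow_isBigO_one n).mul hf
  simp only [one_mul] at this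
  exact this.congr_left fun q => by rw [ev_replicate_append]; ring

lemma tendsto_pow_zero {δ : ℕ} (hδ : 0 < δ) : Tendsto (fun q : ℂ => q ^ δ) (𝓝 0) (𝓝 0) := by
  simpa [hδ.ne'] using (continuous_pow δ).tendsto (0 : ℂ)

lemma Approx.dilate {K : ℕ} {f : ℂ → ℂ} {p : List ℤ} (hf : Approx K f p) {δ : ℕ} (hδ : 0 < δ) :
    Approx K (fun q => f (q ^ δ)) (dilate δ p) := by
  have h1 := IsBigO.comp_tendsto hf (tendsto_pow_zero hδ)
  obtain ⟨n, rfl⟩ := Nat.exists_eq_add_of_lt hδ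
  have h2 := (isBigO_refl (fun q : ℂ => q ^ K) (𝓝 0)).mul (pow_isBigO_one (n * K))
  refine (h1.trans ((h2.congr_left fun q => ?_).congr_right fun q => ?_)).congr_left fun q => ?_
  · simp only [Function.comp_apply]; ring
  · simp
  · simp only [Function.comp_apply, ev_dilate hδ]

lemma multipliable_tail (K : ℕ) {q : ℂ} (hq : ‖q‖ < 1) :
    Multipliable fun n : ℕ => 1 - q ^ (n + K + 1) := by
  simp only [sub_eq_add_neg]
  apply multipliable_one_add_of_summable
  simpa [pow_add, mul_assoc] using
    (summable_geometric_of_lt_one (norm_nonneg q) hq).mul_right (‖q‖ ^ K * ‖q‖)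

/-- Finite products satisfy |∏(1 + f) - 1| ≤ exp(∑|f|) - 1, and the geometric sum of the tail is at
most 2|q|^(K+1). -/
lemma tprod_tail_isBigO (K : ℕ) :
    (fun q : ℂ => ∏' n : ℕ, (1 - q ^ (n + K + 1)) - 1) =O[𝓝 0] fun q => q ^ (K + 1) := by
  refine .of_bound 4 ?_
  -- The radius makes 2|q|^(K+1) ≤ 1, where |exp x - 1| ≤ 2|x| applies; the two factors 2 give the
  -- constant 4.
  filter_upwards [Metric.ball_mem_nhds (0 : ℂ) (by norm_num : (0 : ℝ) < 1 / 4)] with q hq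
  have hq : ‖q‖ < 1 / 4 := by simpa using hq
  have hs : HasSum (fun n : ℕ => ‖-q ^ (n + K + 1)‖) (‖q‖ ^ (K + 1) * (1 - ‖q‖)⁻¹) := by
    simpa [pow_add, mul_comm, mul_assoc, mul_left_comm] using
      (hasSum_geometric_of_lt_one (norm_nonneg q) (by linarith)).mul_left (‖q‖ ^ (K + 1))
  have hm : Multipliable fun n : ℕ => 1 + -q ^ (n + K + 1) :=
    multipliable_one_add_of_summable hs.summable
  have hbound : ‖q‖ ^ (K + 1) * (1 - ‖q‖)⁻¹ ≤ 2 * ‖q‖ ^ (K + 1) := by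
    rw [mul_comm]
    refine mul_le_mul_of_nonneg_right ?_ (by positivity)
    rw [inv_le_comm₀ (by linarith) two_pos]
    linarith
  have hsmall : 2 * ‖q‖ ^ (K + 1) ≤ 1 := by
    have : ‖q‖ ^ (K + 1) ≤ ‖q‖ ^ 1 := pow_le_pow_of_le_one (norm_nonneg _) (by linarith) (by lia)
    rw [pow_one] at this
    linarith
  have hle : ‖∏' n : ℕ, (1 + -q ^ (n + K + 1)) - 1‖ ≤ Real.exp (2 * ‖q‖ ^ (K + 1)) - 1 := by
    refine le_of_tendsto ((hm.hasProd.sub_const 1).norm) (.of_forall fun t => ?_)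
    refine (t.norm_prod_one_add_sub_one_le _).trans ?_
    refine sub_le_sub_right (Real.exp_le_exp.mpr ?_) 1
    exact (hs.summable.sum_le_tsum t fun _ _ => norm_nonneg _).trans (hs.tsum_eq.le.trans hbound)
  have h0 : 0 ≤ 2 * ‖q‖ ^ (K + 1) := by positivity
  have h1 := Real.abs_exp_sub_one_le (x := 2 * ‖q‖ ^ (K + 1)) (by rwa [abs_of_nonneg h0])
  rw [abs_of_nonneg h0] at h1
  simp only [← sub_eq_add_neg] at hle
  rw [norm_pow]
  linarith [le_abs_self (Real.exp (2 * ‖q‖ ^ (K + 1)) - 1)]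

lemma approx_finset_prod (K n : ℕ) :
    Approx K (fun q => ∏ i ∈ Finset.range n, (1 - q ^ (i + 1))) (eulerL K n) := by
  induction n with
  | zero => simpa [eulerL] using Approx.one K
  | succ n ih =>
    simp only [Finset.prod_range_succ]
    refine ih.mul (.of_ev fun q => ?_)
    rw [ev_cons, ev_replicate_append]
    simp
    ring

lemma approx_euler (K : ℕ) : Approx K euler (eulerL K K) := by
  have h1 := tprod_tail_isBigO K
  have h2 := approx_finset_prod K K
  have h3 := h1.mul h2.isBigO_one
  have h4 : (fun q : ℂ => q ^ (K + 1)) =O[𝓝 0] fun q => q ^ K := by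
    simpa [pow_succ] using (isBigO_refl (fun q : ℂ => q ^ K) (𝓝 0)).mul (pow_isBigO_one 1)
  have h5 := (h3.trans (by simpa using h4)).add h2
  refine h5.congr' ?_ EventuallyEq.rfl
  filter_upwards [Metric.ball_mem_nhds (0 : ℂ) one_pos] with q hq
  have := Multipliable.prod_mul_tprod_nat_mul' (k := K) (f := fun n : ℕ => 1 - q ^ (n + 1))
    (multipliable_tail K (by simpa using hq))
  rw [euler, ← this]
  ring

/-- From f r = 1 + O(q^K), multiplication by the bounded function 1/f gives r = 1/f + O(q^K). -/
lemma Approx.inv {K : ℕ} {f : ℂ → ℂ} {p r : List ℤ} (hf : Approx K f p) (h1 : Tendsto f (𝓝 0) (𝓝 1))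
    (h : mulT K p r = [1] ++ List.replicate (K - 1) 0) : Approx K (fun q => (f q)⁻¹) r := by
  have h2 := hf.mul (Approx.of_ev (K := K) (f := ev r) (p := r) fun _ => rfl)
  rw [h] at h2
  have h3 := (h1.inv₀ one_ne_zero).isBigO_one ℂ
  have h4 := h3.mul h2
  simp only [one_mul] at h4
  refine h4.neg_left.congr' ?_ EventuallyEq.rfl
  filter_upwards [h1.eventually_ne one_ne_zero] with q hq
  have : ev ([1] ++ List.replicate (K - 1) 0) q = 1 := by
    have := ev_replicate_append (K - 1) [] q
    simp only [List.append_nil, ev_nil, mul_zero] at this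
    simp [this]
  rw [this]
  field_simp
  ring

/-- The coefficients of the Euler product up to `q ^ 12`. -/
def eulerCoeffs : List ℤ := [1, -1, -1, 0, 0, 1, 0, 1, 0, 0, 0, 0, -1]

/-- The coefficients of the inverse of the Euler product up to `q ^ 12`. -/
def partitionCoeffs : List ℤ := [1, 1, 2, 3, 5, 7, 11, 15, 22, 30, 42, 56, 77]

/-- Precision 13 is enough: the relations have poles of order at most 12 at infinity after
multiplication by g, and the constant term is also needed. -/
lemma approx_eulerCoeffs : Approx 13 euler eulerCoeffs := by
  have h : eulerL 13 13 = eulerCoeffs := by decide +kernel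
  exact h ▸ approx_euler 13

lemma approx_partitionCoeffs : Approx 13 (fun q => (euler q)⁻¹) partitionCoeffs :=
  approx_eulerCoeffs.inv tendsto_euler (by decide +kernel)

/-- The series of `euler ^ s` modulo `q ^ 13`. -/
def eulerPow (s : ℤ) : List ℤ :=
  powT 13 (if 0 ≤ s then eulerCoeffs else partitionCoeffs) s.natAbs

lemma approx_eulerPow (s : ℤ) : Approx 13 (fun q => euler q ^ s) (eulerPow s) := by
  rcases le_or_gt 0 s with h | h
  · lift s to ℕ using h
    simpa [eulerPow] using approx_eulerCoeffs.pow s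
  · obtain ⟨n, rfl⟩ : ∃ n : ℕ, s = -n := ⟨s.natAbs, by lia⟩
    have h' : n ≠ 0 := by lia
    simpa [eulerPow, h'] using approx_partitionCoeffs.pow n

/-- The series of `∏ᵢ euler (q ^ aᵢ) ^ dᵢ` modulo `q ^ 13`. -/
def series : List (ℕ × ℤ) → List ℤ
  | [] => [1]
  | p :: l => mulT 13 ((dilate p.1 (eulerPow p.2)).take 13) (series l)

/-- The function `∏ᵢ euler (q ^ aᵢ) ^ dᵢ`. -/
noncomputable def eulerQuotient (l : List (ℕ × ℤ)) (q : ℂ) : ℂ :=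
  (l.map fun p => euler (q ^ p.1) ^ p.2).prod

lemma approx_series {l : List (ℕ × ℤ)} (hl : ∀ p ∈ l, 0 < p.1) :
    Approx 13 (eulerQuotient l) (series l) := by
  induction l with
  | nil => exact Approx.one 13
  | cons p l ih =>
    exact ((approx_eulerPow p.2).dilate (hl p (by simp))).take.mul (ih fun p hp => hl p (by simp [hp]))

/-- The order of `etaQuotient l` at infinity, times 24. -/
def order (l : List (ℕ × ℤ)) : ℤ := (l.map fun p => (p.1 : ℤ) * p.2).sum

lemma etaQuotient_eq (l : List (ℕ × ℤ)) (τ : ℍ) :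
    etaQuotient l τ = cexp (2 * Real.pi * Complex.I * τ / 24) ^ order l *
      eulerQuotient l (cexp (2 * Real.pi * Complex.I * τ)) := by
  induction l with
  | nil => simp [order, eulerQuotient]
  | cons p l ih =>
    rw [etaQuotient_cons, ih, eta_eq]
    simp only [order, eulerQuotient, List.map_cons, List.sum_cons, List.prod_cons]
    rw [zpow_add₀ (Complex.exp_ne_zero _), mul_zpow, ← Complex.exp_nat_mul,
      ← Complex.exp_int_mul, ← Complex.exp_int_mul (_ / 24) (p.1 * p.2)]
    have h1 : (p.2 : ℂ) * (2 * Real.pi * Complex.I * (p.1 * τ) / 24) =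
        ((p.1 * p.2 : ℤ) : ℂ) * (2 * Real.pi * Complex.I * τ / 24) := by push_cast; ring
    have h2 : 2 * Real.pi * Complex.I * (p.1 * τ) = p.1 * (2 * Real.pi * Complex.I * τ) := by ring
    rw [h1, h2]
    ring

lemma etaQuotient_mul_pow {l : List (ℕ × ℤ)} {n M : ℕ} (h : order l + 24 * M = 24 * n) (τ : ℍ) :
    etaQuotient l τ * cexp (2 * Real.pi * Complex.I * τ) ^ M =
      cexp (2 * Real.pi * Complex.I * τ) ^ n *
        eulerQuotient l (cexp (2 * Real.pi * Complex.I * τ)) := by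
  set e := cexp (2 * Real.pi * Complex.I * τ / 24) with he
  have h1 : cexp (2 * Real.pi * Complex.I * τ) = e ^ (24 : ℤ) := by
    rw [he, ← Complex.exp_int_mul]; congr 1; push_cast; ring
  have h2 : order l = 24 * n - 24 * M := by lia
  have he0 : e ≠ 0 := Complex.exp_ne_zero _
  rw [etaQuotient_eq, ← he, h1, h2, zpow_sub₀ he0, zpow_mul, zpow_mul, zpow_natCast, zpow_natCast]
  field_simp

/-- A linear combination of the functions `etaQuotient l`. -/
noncomputable def comb (T : List (ℤ × List (ℕ × ℤ))) (τ : ℍ) : ℂ :=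
  (T.map fun t => (t.1 : ℂ) * etaQuotient t.2 τ).sum

/-- The power of `q` in `q ^ M * etaQuotient l`. -/
def shiftBy (M : ℕ) (l : List (ℕ × ℤ)) : ℕ := ((order l + 24 * M) / 24).toNat

/-- The series of `q ^ M * comb T` modulo `q ^ 13`. -/
def combSeries (M : ℕ) : List (ℤ × List (ℕ × ℤ)) → List ℤ
  | [] => []
  | t :: T => addL ((List.replicate (shiftBy M t.2) 0 ++ series t.2).map (t.1 * ·)) (combSeries M T)

/-- As `shiftBy` rounds and truncates at 0, the equation in `hT` is what ensures that each term has
an integral order, at least -M. -/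
lemma exists_approx_comb {M : ℕ} {T : List (ℤ × List (ℕ × ℤ))}
    (hT : ∀ t ∈ T, (∀ p ∈ t.2, 0 < p.1) ∧ order t.2 + 24 * M = 24 * shiftBy M t.2) :
    ∃ f : ℂ → ℂ, Approx 13 f (combSeries M T) ∧ ∀ τ : ℍ,
      comb T τ * cexp (2 * Real.pi * Complex.I * τ) ^ M = f (cexp (2 * Real.pi * Complex.I * τ)) := by
  induction T with
  | nil => exact ⟨fun _ => 0, .of_ev fun q => by simp [combSeries], fun τ => by simp [comb]⟩
  | cons t T ih =>
    obtain ⟨f, hf, h⟩ := ih fun t ht => hT t (by simp [ht])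
    obtain ⟨h1, h2⟩ := hT t (by simp)
    refine ⟨_, (((approx_series h1).shift (shiftBy M t.2)).const_mul t.1).add hf, fun τ => ?_⟩
    rw [← h τ, ← etaQuotient_mul_pow h2 τ]
    simp only [comb, List.map_cons, List.sum_cons]
    ring

/-- If the series vanishes through `q ^ M`, then `comb T` vanishes at infinity. -/
lemma isZeroAtImInfty_comb {M : ℕ} (hM : M < 13) {T : List (ℤ × List (ℕ × ℤ))}
    (hT : ∀ t ∈ T, (∀ p ∈ t.2, 0 < p.1) ∧ order t.2 + 24 * M = 24 * shiftBy M t.2)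
    (h : ∀ a ∈ (combSeries M T).take (M + 1), a = 0) : IsZeroAtImInfty (comb T) := by
  obtain ⟨f, hf, H⟩ := exists_approx_comb hT
  have h0 (p : List ℤ) (hp : ∀ a ∈ p, a = 0) (q : ℂ) : ev p q = 0 := by
    induction p with
    | nil => rfl
    | cons a p ih => simp [hp a (by simp), ih fun a ha => hp a (by simp [ha])]
  have h1 : f =O[𝓝 0] fun q => q ^ (M + 1) := by
    obtain ⟨k, hk⟩ := Nat.exists_eq_add_of_le (show M + 1 ≤ 13 from hM)
    have h2 : (fun q : ℂ => q ^ 13) =O[𝓝 0] fun q => q ^ (M + 1) := by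
      rw [hk]
      simpa [pow_add _ (M + 1) k] using
        (isBigO_refl (fun q : ℂ => q ^ (M + 1)) (𝓝 0)).mul (pow_isBigO_one k)
    refine ((IsBigO.trans hf h2).add (mul_ev_isBigO (M + 1) ((combSeries M T).drop (M + 1)))).congr_left
      fun q => ?_
    rw [ev_eq_take_add_drop (M + 1) (combSeries M T), h0 _ h]
    ring
  have h2 := h1.comp_tendsto tendsto_q
  have h3 : comb T =O[atImInfty] fun τ : ℍ => cexp (2 * Real.pi * Complex.I * τ) := by
    have := (isBigO_refl (fun τ : ℍ => (cexp (2 * Real.pi * Complex.I * τ) ^ M)⁻¹) atImInfty).mul h2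
    refine (this.congr_left fun τ => ?_).congr_right fun τ => ?_
    · rw [Function.comp_apply, ← H]
      field_simp [Complex.exp_ne_zero]
    · simp only [Function.comp_apply]
      field_simp [Complex.exp_ne_zero]
      ring
  exact h3.trans_tendsto tendsto_q

end EtaQuotient

/-! ### The vanishing criterion -/

namespace EtaQuotient

open ModularForm MatrixGroups Filter Asymptotics Topology
open Complex hiding eta I
open scoped Manifold

lemma etaQuotient_ne_zero {l : List (ℕ × ℤ)} (hl : ∀ p ∈ l, 0 < p.1) (τ : ℍ) : etaQuotient l τ ≠ 0 := by
  induction l with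
  | nil => simp
  | cons p l ih =>
    rw [etaQuotient_cons]
    exact mul_ne_zero (zpow_ne_zero _ (eta_smul_ne_zero (hl p (by simp)) τ))
      (ih fun p hp => hl p (by simp [hp]))

lemma mdifferentiable_etaQuotient {l : List (ℕ × ℤ)} (hl : ∀ p ∈ l, 0 < p.1) : MDiff (etaQuotient l) := by
  rw [UpperHalfPlane.mdifferentiable_iff]
  have h : DifferentiableOn ℂ (fun z : ℂ => (l.map fun p => eta (p.1 * z) ^ p.2).prod)
      {z | 0 < z.im} := by
    induction l with
    | nil => exact differentiableOn_const 1
    | cons p l ih =>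
      refine DifferentiableOn.mul (fun z hz => ?_) (ih fun p hp => hl p (by simp [hp]))
      exact ((differentiableAt_eta_smul (hl p (by simp)) ⟨z, hz⟩).zpow
        (.inl (eta_smul_ne_zero (hl p (by simp)) ⟨z, hz⟩))).differentiableWithinAt
  refine h.congr fun z hz => ?_
  simp [etaQuotient, ofComplex_apply_of_im_pos hz]

lemma mdifferentiable_comb {T : List (ℤ × List (ℕ × ℤ))} (hT : ∀ t ∈ T, ∀ p ∈ t.2, 0 < p.1) :
    MDiff (comb T) := by
  induction T with
  | nil => exact mdifferentiable_const
  | cons t T ih =>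
    exact (mdifferentiable_const.mul (mdifferentiable_etaQuotient (hT t (by simp)))).add
      (ih fun t ht => hT t (by simp [ht]))

/-- This leaves finitely many c to test. The class c = 0, the cusp infinity, is left free in
`Admissible`: poles there are handled by the q-expansion. -/
lemma cuspOrder_emod {N : ℕ} {l : List (ℕ × ℤ)} (hl : ∀ p ∈ l, p.1 ∣ N) (c : ℤ) :
    cuspOrder N l (c % N) = cuspOrder N l c := by
  unfold cuspOrder
  congr 1
  refine List.map_congr_left fun p hp => ?_
  obtain ⟨k, hk⟩ := hl p hp
  have : Int.gcd (c % N) p.1 = Int.gcd c p.1 := by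
    rw [Int.emod_def, hk]
    push_cast
    rw [mul_assoc, mul_comm, Int.gcd_sub_mul_right_left]
  rw [this]

/-- A criterion for `etaQuotient l` to be invariant under `Γ₀(N)` without poles outside infinity. -/
def Admissible (N : ℕ) (l : List (ℕ × ℤ)) : Prop :=
  (∀ p ∈ l, 2 ∣ p.2) ∧ (∀ p ∈ l, p.1 ∣ N) ∧ Invariant N (halve l) ∧
    ∀ c < N, 0 < c → 0 ≤ cuspOrder N (halve l) c

instance (N : ℕ) (l : List (ℕ × ℤ)) : Decidable (Admissible N l) := by
  unfold Admissible; infer_instance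

lemma Admissible.smul {N : ℕ} (hN : 0 < N) {l : List (ℕ × ℤ)} (hl : Admissible N l)
    {γ : SL(2, ℤ)} (hγ : (N : ℤ) ∣ γ 1 0) (τ : ℍ) :
    etaQuotient l (γ • τ) = etaQuotient l τ := by
  rw [← etaSq_halve hl.1, ← etaSq_halve hl.1, hl.2.2.1.smul hN hγ]

lemma Admissible.isBoundedAtImInfty_smul {N : ℕ} (hN : 0 < N) {l : List (ℕ × ℤ)}
    (hl : Admissible N l) {γ : SL(2, ℤ)} (hγ : ¬ (N : ℤ) ∣ γ 1 0) :
    IsBoundedAtImInfty fun τ => etaQuotient l (γ • τ) := by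
  obtain ⟨h2, -, ⟨hw, hd, -⟩, hc⟩ := hl
  simp only [← etaSq_halve h2]
  refine isBoundedAtImInfty_etaSq_smul hN hd hw ?_
  rw [← cuspOrder_emod hd]
  have hN' : (0 : ℤ) < N := by exact_mod_cast hN
  have h1 := Int.emod_nonneg (γ 1 0) hN'.ne'
  have h2 := Int.emod_lt_of_pos (γ 1 0) hN'
  have h3 : γ 1 0 % N ≠ 0 := fun h => hγ (Int.dvd_of_emod_eq_zero h)
  obtain ⟨m, hm⟩ := Int.eq_ofNat_of_zero_le h1
  rw [hm] at h2 h3 ⊢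
  exact hc m (by lia) (by lia)

/-- A computable criterion for `comb T` to vanish at infinity. -/
def SmallAtInfty (M : ℕ) (T : List (ℤ × List (ℕ × ℤ))) : Prop :=
  M < 13 ∧ (∀ t ∈ T, (∀ p ∈ t.2, 0 < p.1) ∧ order t.2 + 24 * M = 24 * shiftBy M t.2) ∧
    ∀ a ∈ (combSeries M T).take (M + 1), a = 0

instance (M : ℕ) (T : List (ℤ × List (ℕ × ℤ))) : Decidable (SmallAtInfty M T) := by
  unfold SmallAtInfty; infer_instance

lemma SmallAtInfty.isZeroAtImInfty {M : ℕ} {T : List (ℤ × List (ℕ × ℤ))} (h : SmallAtInfty M T) :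
    IsZeroAtImInfty (comb T) :=
  isZeroAtImInfty_comb h.1 h.2.1 h.2.2

lemma comb_smul {N : ℕ} (hN : 0 < N) {T : List (ℤ × List (ℕ × ℤ))}
    (hT : ∀ t ∈ T, Admissible N t.2) {γ : SL(2, ℤ)} (hγ : (N : ℤ) ∣ γ 1 0) (τ : ℍ) :
    comb T (γ • τ) = comb T τ := by
  unfold comb
  congr 1
  exact List.map_congr_left fun t ht => by rw [(hT t ht).smul hN hγ]

lemma isBoundedAtImInfty_comb_smul {N : ℕ} (hN : 0 < N) {T : List (ℤ × List (ℕ × ℤ))}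
    (hT : ∀ t ∈ T, Admissible N t.2) {γ : SL(2, ℤ)} (hγ : ¬ (N : ℤ) ∣ γ 1 0) :
    IsBoundedAtImInfty fun τ => comb T (γ • τ) := by
  induction T with
  | nil => exact isBigO_zero _ _
  | cons t T ih =>
    exact (((hT t (by simp)).isBoundedAtImInfty_smul hN hγ).const_mul_left _).add
      (ih fun t ht => hT t (by simp [ht]))

theorem comb_eq_zero {N M : ℕ} (hN : 0 < N) {T : List (ℤ × List (ℕ × ℤ))}
    (hT : ∀ t ∈ T, Admissible N t.2) (hs : SmallAtInfty M T) (τ : ℍ) : comb T τ = 0 := by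
  have : NeZero N := ⟨hN.ne'⟩
  have hzero := hs.isZeroAtImInfty
  have hslash (γ : SL(2, ℤ)) : comb T ∣[(0 : ℤ)] γ = fun τ => comb T (γ • τ) := by
    ext τ
    simp [SL_slash_apply]
  let F : ModularForm (CongruenceSubgroup.Gamma0 N : Subgroup (GL (Fin 2) ℝ)) 0 :=
    { toFun := comb T
      slash_action_eq' := by
        rintro _ ⟨γ, hγ, rfl⟩
        refine (hslash γ).trans (funext fun τ => comb_smul hN hT ?_ τ)
        exact (ZMod.intCast_zmod_eq_zero_iff_dvd _ _).mp (CongruenceSubgroup.Gamma0_mem.mp hγ)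
      holo' := mdifferentiable_comb fun t ht => (hs.2.1 t ht).1
      bdd_at_cusps' := by
        intro c hc
        rw [Subgroup.IsArithmetic.isCusp_iff_isCusp_SL2Z] at hc
        rw [OnePoint.isBoundedAt_iff_forall_SL2Z hc]
        intro γ _
        rw [hslash]
        -- If N divides c, then γ lies in Γ₀(N) and the cusp is equivalent to infinity, where the
        -- function tends to 0. At the other cusps every term is bounded.
        by_cases hγ : (N : ℤ) ∣ γ 1 0
        · simp only [comb_smul hN hT hγ]
          exact hzero.isBoundedAtImInfty
        · exact isBoundedAtImInfty_comb_smul hN hT hγ }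
  obtain ⟨c, hc⟩ := ModularForm.eq_const_of_weight_zero F
  have hc' : comb T = Function.const ℍ c := hc
  have hlim : Tendsto (comb T) atImInfty (𝓝 0) := hzero
  rw [hc'] at hlim ⊢
  exact tendsto_nhds_unique tendsto_const_nhds hlim

/-- The exponent of `η(δ τ)` in `etaQuotient l`. -/
def expo (l : List (ℕ × ℤ)) (δ : ℕ) : ℤ := (l.map fun p => if p.1 = δ then p.2 else 0).sum

lemma etaQuotient_map (L : List ℕ) (f : ℕ → ℤ) (τ : ℍ) :
    etaQuotient (L.map fun δ => (δ, f δ)) τ = (L.map fun δ : ℕ => eta (δ * τ) ^ f δ).prod := by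
  simp [etaQuotient, Function.comp_def]

lemma etaQuotient_map_add {L : List ℕ} (hL : ∀ δ ∈ L, 0 < δ) (f g : ℕ → ℤ) (τ : ℍ) :
    etaQuotient (L.map fun δ => (δ, f δ + g δ)) τ =
      etaQuotient (L.map fun δ => (δ, f δ)) τ * etaQuotient (L.map fun δ => (δ, g δ)) τ := by
  simp only [etaQuotient_map, ← List.prod_map_mul]
  congr 1
  exact List.map_congr_left fun δ hδ => zpow_add₀ (eta_smul_ne_zero (hL δ hδ) τ) _ _

lemma etaQuotient_map_mul (L : List ℕ) (f : ℕ → ℤ) (n : ℤ) (τ : ℍ) :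
    etaQuotient (L.map fun δ => (δ, n * f δ)) τ =
      etaQuotient (L.map fun δ => (δ, f δ)) τ ^ n := by
  induction L with
  | nil => simp
  | cons δ L ih =>
    simp only [List.map_cons, etaQuotient_cons]
    rw [ih, mul_zpow, ← zpow_mul, mul_comm n]

lemma etaQuotient_map_expo {L : List ℕ} (hL : ∀ δ ∈ L, 0 < δ) (hn : L.Nodup) {l : List (ℕ × ℤ)}
    (hl : ∀ p ∈ l, p.1 ∈ L) (τ : ℍ) :
    etaQuotient (L.map fun δ => (δ, expo l δ)) τ = etaQuotient l τ := by
  induction l with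
  | nil => simp [expo, etaQuotient_map]
  | cons p l ih =>
    rw [etaQuotient_cons, ← ih fun p hp => hl p (by simp [hp])]
    simp only [expo, List.map_cons, List.sum_cons]
    rw [etaQuotient_map_add hL, etaQuotient_map]
    congr 1
    rw [List.prod_map_eq_pow_single p.1 _ fun δ hδ _ => by simp [hδ.symm]]
    simp [List.count_eq_one_of_mem hn (hl p (by simp))]

/-- The exponents of `g * ∏ₖ (gens k) ^ (e k)`, as a list supported on `L`. -/
def monomial (L : List ℕ) (gens : List (List (ℕ × ℤ))) (g : List (ℕ × ℤ)) (e : List ℤ) :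
    List (ℕ × ℤ) :=
  L.map fun δ => (δ, (List.zipWith (fun l i => i * expo l δ) gens e).sum + expo g δ)

/-- Exponents of the same η(δτ) must be merged before testing parity: a monomial can be even
although its generators are not. -/
lemma etaQuotient_monomial {L : List ℕ} (hL : ∀ δ ∈ L, 0 < δ) (hn : L.Nodup)
    {gens : List (List (ℕ × ℤ))} (hgens : ∀ l ∈ gens, ∀ p ∈ l, p.1 ∈ L) {g : List (ℕ × ℤ)}
    (hg : ∀ p ∈ g, p.1 ∈ L) (e : List ℤ) (τ : ℍ) :
    etaQuotient (monomial L gens g e) τ =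
      (List.zipWith (fun l i => etaQuotient l τ ^ i) gens e).prod * etaQuotient g τ := by
  unfold monomial
  induction gens generalizing e with
  | nil => simp [etaQuotient_map_expo hL hn hg]
  | cons l gens ih =>
    cases e with
    | nil => simp [etaQuotient_map_expo hL hn hg]
    | cons i e =>
      simp only [List.zipWith_cons_cons, List.sum_cons, List.prod_cons, add_assoc]
      rw [etaQuotient_map_add hL, etaQuotient_map_mul,
        etaQuotient_map_expo hL hn (hgens l (by simp)), ih fun l hl => hgens l (by simp [hl])]
      ring

/-- The terms of `g * ∑ c * ∏ₖ (gens k) ^ (e k)`. -/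
def terms (L : List ℕ) (gens : List (List (ℕ × ℤ))) (g : List (ℕ × ℤ)) (R : List (ℤ × List ℤ)) :
    List (ℤ × List (ℕ × ℤ)) :=
  R.map fun r => (r.1, monomial L gens g r.2)

/-- The value of the Laurent polynomial `∑ c * ∏ₖ (gens k) ^ (e k)`. -/
noncomputable def laurent (gens : List (List (ℕ × ℤ))) (R : List (ℤ × List ℤ)) (τ : ℍ) : ℂ :=
  (R.map fun r => (r.1 : ℂ) * (List.zipWith (fun l i => etaQuotient l τ ^ i) gens r.2).prod).sum

lemma comb_terms {L : List ℕ} (hL : ∀ δ ∈ L, 0 < δ) (hn : L.Nodup)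
    {gens : List (List (ℕ × ℤ))} (hgens : ∀ l ∈ gens, ∀ p ∈ l, p.1 ∈ L) {g : List (ℕ × ℤ)}
    (hg : ∀ p ∈ g, p.1 ∈ L) (R : List (ℤ × List ℤ)) (τ : ℍ) :
    comb (terms L gens g R) τ = laurent gens R τ * etaQuotient g τ := by
  simp only [comb, terms, laurent, List.map_map, Function.comp_def,
    etaQuotient_monomial hL hn hgens hg, ← mul_assoc, List.sum_map_mul_right]

/-- All the pairs have a first entry in `L`, which is a list of distinct positive integers. -/
def Supported (L : List ℕ) (gens : List (List (ℕ × ℤ))) (g : List (ℕ × ℤ)) : Prop :=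
  (∀ δ ∈ L, 0 < δ) ∧ L.Nodup ∧ (∀ l ∈ gens, ∀ p ∈ l, p.1 ∈ L) ∧ ∀ p ∈ g, p.1 ∈ L

instance (L : List ℕ) (gens : List (List (ℕ × ℤ))) (g : List (ℕ × ℤ)) :
    Decidable (Supported L gens g) := by
  unfold Supported; infer_instance

/-- A polynomial relation between `η`-quotients of level `N` follows from a finite computation,
once a multiplier `g` clears the poles at all the cusps other than infinity. -/
theorem laurent_eq_zero {N : ℕ} (M : ℕ) (L : List ℕ) {gens : List (List (ℕ × ℤ))}
    (g : List (ℕ × ℤ)) {R : List (ℤ × List ℤ)}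
    (h : 0 < N ∧ Supported L gens g ∧ (∀ t ∈ terms L gens g R, Admissible N t.2) ∧
      SmallAtInfty M (terms L gens g R)) (τ : ℍ) : laurent gens R τ = 0 := by
  obtain ⟨hN, ⟨hL, hn, hgens, hg⟩, hT, hs⟩ := h
  have := comb_eq_zero hN hT hs τ
  rw [comb_terms hL hn hgens hg] at this
  exact (mul_eq_zero.mp this).resolve_right (etaQuotient_ne_zero (fun p hp => hL _ (hg p hp)) τ)

end EtaQuotient

/-! ### Relations with odd exponents -/

namespace EtaQuotient

open ModularForm MatrixGroups Filter Asymptotics Topology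
open Complex hiding eta I
open scoped Manifold

lemma laurent_nil (gens : List (List (ℕ × ℤ))) (τ : ℍ) : laurent gens [] τ = 0 := rfl

lemma laurent_cons (gens : List (List (ℕ × ℤ))) (r : ℤ × List ℤ) (R : List (ℤ × List ℤ)) (τ : ℍ) :
    laurent gens (r :: R) τ =
      r.1 * (List.zipWith (fun l i => etaQuotient l τ ^ i) gens r.2).prod + laurent gens R τ :=
  rfl

lemma zipWith_zpow_nil (τ : ℍ) :
    (List.zipWith (fun l i => etaQuotient l τ ^ (i : ℤ)) [] []).prod = 1 := rfl

lemma zipWith_zpow_cons (l : List (ℕ × ℤ)) (gens : List (List (ℕ × ℤ))) (i : ℤ) (e : List ℤ)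
    (τ : ℍ) : (List.zipWith (fun l i => etaQuotient l τ ^ i) (l :: gens) (i :: e)).prod =
      etaQuotient l τ ^ i * (List.zipWith (fun l i => etaQuotient l τ ^ i) gens e).prod := by
  simp

lemma mdifferentiable_laurent {L : List ℕ} {gens : List (List (ℕ × ℤ))}
    (h : Supported L gens []) (R : List (ℤ × List ℤ)) : MDiff (laurent gens R) := by
  obtain ⟨hL, hn, hgens, hg⟩ := h
  have h1 : laurent gens R = comb (terms L gens [] R) := by
    ext τ
    simp [comb_terms hL hn hgens hg]
  rw [h1]
  refine mdifferentiable_comb fun t ht p hp => ?_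
  obtain ⟨r, -, rfl⟩ := List.mem_map.mp ht
  obtain ⟨δ, hδ, rfl⟩ := List.mem_map.mp hp
  exact hL δ hδ

/-- If `F₁ * F₂ = 0`, and `F₂` does not vanish since `F₂ * w` has a nonzero limit `c` at infinity,
then `F₁ = 0`. -/
theorem laurent_eq_zero_of_mul {L : List ℕ} {gens : List (List (ℕ × ℤ))}
    {R₁ R₂ : List (ℤ × List ℤ)} (hg : Supported L gens []) (M : ℕ) (w : List (ℕ × ℤ)) (c : ℤ)
    (hw : c ≠ 0 ∧ (∀ p ∈ w, p.1 ∈ L) ∧ SmallAtInfty M ((-c, []) :: terms L gens w R₂))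
    (h : ∀ τ, laurent gens R₁ τ * laurent gens R₂ τ = 0) (τ : ℍ) : laurent gens R₁ τ = 0 := by
  have h1 := mdifferentiable_laurent hg R₁
  have h2 := mdifferentiable_laurent hg R₂
  rcases (mul_eq_zero_iff h1 h2).mp (funext h) with h0 | h0
  · exact congrFun h0 τ
  · obtain ⟨hc, hw, hs⟩ := hw
    -- The empty η-quotient is 1, so this combination is w F₂ - c; with F₂ = 0 it would be the
    -- constant -c.
    have hlim : Tendsto (comb ((-c, []) :: terms L gens w R₂)) atImInfty (𝓝 0) :=
      hs.isZeroAtImInfty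
    have hconst : comb ((-c, []) :: terms L gens w R₂) = fun _ => -(c : ℂ) := by
      ext τ
      have := comb_terms hg.1 hg.2.1 hg.2.2.1 hw R₂ τ
      simp only [comb, h0, Pi.zero_apply, zero_mul, List.map_cons, List.sum_cons] at this ⊢
      simp [this]
    rw [hconst] at hlim
    have := tendsto_nhds_unique hlim tendsto_const_nhds
    simp [eq_comm, hc] at this

/-! ### The relations, level by level -/

theorem relation_level_four (τ : ℍ) {z y : ℂ}
    (hz : z = etaQuotient [(1, 4), (4, -4)] τ)
    (hy : y = etaQuotient [(2, 24), (1, -12), (4, -12)] τ) :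
    z + 16 * z⁻¹ = y := by
  have hz0 : z ≠ 0 := hz ▸ etaQuotient_ne_zero (by decide) τ
  have hy0 : y ≠ 0 := hy ▸ etaQuotient_ne_zero (by decide) τ
  -- Both y and z have order -1/2 at infinity and change sign under τ ↦ τ + 1. The multiplier g = z
  -- restores invariance as well as clearing poles.
  have h := laurent_eq_zero (N := 4) 1 [1, 2, 4] [(1, 4), (4, -4)]
    (gens := [[(1, 4), (4, -4)], [(2, 24), (1, -12), (4, -12)]])
    (R := [(1, [1, 0]), (-1, [0, 1]), (16, [-1, 0])])
    (by decide +kernel) τ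
  simp only [laurent_nil, laurent_cons, zipWith_zpow_cons, zipWith_zpow_nil, ← hz, ← hy] at h
  rw [← sub_eq_zero]
  refine Eq.trans ?_ h
  push_cast
  field_simp
  ring

theorem relation_level_eight_add_four (τ : ℍ) {z y : ℂ}
    (hz : z = etaQuotient [(2, -4), (4, 12), (8, -8)] τ)
    (hy : y = etaQuotient [(1, 4), (4, 2), (2, -2), (8, -4)] τ) :
    y + 4 = z := by
  have hz0 : z ≠ 0 := hz ▸ etaQuotient_ne_zero (by decide) τ
  have hy0 : y ≠ 0 := hy ▸ etaQuotient_ne_zero (by decide) τ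
  have h := laurent_eq_zero (N := 8) 1 [1, 2, 4, 8] []
    (gens := [[(2, -4), (4, 12), (8, -8)], [(1, 4), (4, 2), (2, -2), (8, -4)]])
    (R := [(-1, [1, 0]), (1, [0, 1]), (4, [0, 0])])
    (by decide +kernel) τ
  simp only [laurent_nil, laurent_cons, zipWith_zpow_cons, zipWith_zpow_nil, ← hz, ← hy] at h
  rw [← sub_eq_zero]
  refine Eq.trans ?_ h
  push_cast
  field_simp
  ring

theorem relation_level_eight_add_eight (τ : ℍ) {z y : ℂ}
    (hz : z = etaQuotient [(1, -4), (2, 10), (4, -2), (8, -4)] τ)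
    (hy : y = etaQuotient [(1, 4), (4, 2), (2, -2), (8, -4)] τ) :
    y + 8 = z := by
  have hz0 : z ≠ 0 := hz ▸ etaQuotient_ne_zero (by decide) τ
  have hy0 : y ≠ 0 := hy ▸ etaQuotient_ne_zero (by decide) τ
  have h := laurent_eq_zero (N := 8) 1 [1, 2, 4, 8] []
    (gens := [[(1, -4), (2, 10), (4, -2), (8, -4)], [(1, 4), (4, 2), (2, -2), (8, -4)]])
    (R := [(-1, [1, 0]), (1, [0, 1]), (8, [0, 0])])
    (by decide +kernel) τ
  simp only [laurent_nil, laurent_cons, zipWith_zpow_cons, zipWith_zpow_nil, ← hz, ← hy] at h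
  rw [← sub_eq_zero]
  refine Eq.trans ?_ h
  push_cast
  field_simp
  ring

theorem relation_level_six_one_three (τ : ℍ) {z y : ℂ}
    (hz : z = etaQuotient [(1, 12), (3, -12)] τ)
    (hy : y = etaQuotient [(1, 6), (3, 6), (2, -6), (6, -6)] τ) :
    z + 729 * z⁻¹ + 54 = (y + 16) ^ 3 * (y ^ 2)⁻¹ := by
  have hz0 : z ≠ 0 := hz ▸ etaQuotient_ne_zero (by decide) τ
  have hy0 : y ≠ 0 := hy ▸ etaQuotient_ne_zero (by decide) τ
  -- R is the expanded difference of the two sides. M is the pole order at infinity: 5 from g and 1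
  -- from y and z.
  have h := laurent_eq_zero (N := 6) 6 [1, 2, 3, 6] [(2, 12), (3, 24), (6, -36)]
    (gens := [[(1, 12), (3, -12)], [(1, 6), (3, 6), (2, -6), (6, -6)]])
    (R := [(1, [1, 0]), (-1, [0, 1]), (6, [0, 0]), (-768, [0, -1]), (-4096, [0, -2]),
         (729, [-1, 0])])
    (by decide +kernel) τ
  simp only [laurent_nil, laurent_cons, zipWith_zpow_cons, zipWith_zpow_nil, ← hz, ← hy] at h
  rw [← sub_eq_zero]
  refine Eq.trans ?_ h
  push_cast
  field_simp
  ring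

theorem relation_level_six_two_six (τ : ℍ) {z y : ℂ}
    (hz : z = etaQuotient [(2, 12), (6, -12)] τ)
    (hy : y = etaQuotient [(1, 6), (3, 6), (2, -6), (6, -6)] τ) :
    z + 729 * z⁻¹ + 54 = (y + 4) ^ 3 * y⁻¹ := by
  have hz0 : z ≠ 0 := hz ▸ etaQuotient_ne_zero (by decide) τ
  have hy0 : y ≠ 0 := hy ▸ etaQuotient_ne_zero (by decide) τ
  have h := laurent_eq_zero (N := 6) 6 [1, 2, 3, 6] [(1, -6), (2, 18), (3, 18), (6, -30)]
    (gens := [[(2, 12), (6, -12)], [(1, 6), (3, 6), (2, -6), (6, -6)]])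
    (R := [(1, [1, 0]), (-1, [0, 2]), (-12, [0, 1]), (6, [0, 0]), (-64, [0, -1]), (729, [-1, 0])])
    (by decide +kernel) τ
  simp only [laurent_nil, laurent_cons, zipWith_zpow_cons, zipWith_zpow_nil, ← hz, ← hy] at h
  rw [← sub_eq_zero]
  refine Eq.trans ?_ h
  push_cast
  field_simp
  ring

theorem relation_level_six_one_two (τ : ℍ) {z y : ℂ}
    (hz : z = etaQuotient [(1, 12), (2, -12)] τ)
    (hy : y = etaQuotient [(1, 2), (2, 2), (3, -2), (6, -2)] τ) :
    z + 64 * z⁻¹ = (y ^ 2 + 27) ^ 2 * (y ^ 3)⁻¹ := by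
  have hz0 : z ≠ 0 := hz ▸ etaQuotient_ne_zero (by decide) τ
  have hy0 : y ≠ 0 := hy ▸ etaQuotient_ne_zero (by decide) τ
  have h := laurent_eq_zero (N := 6) 4 [1, 2, 3, 6] [(2, 12), (3, 12), (6, -24)]
    (gens := [[(1, 12), (2, -12)], [(1, 2), (2, 2), (3, -2), (6, -2)]])
    (R := [(1, [1, 0]), (-1, [0, 1]), (-54, [0, -1]), (-729, [0, -3]), (64, [-1, 0])])
    (by decide +kernel) τ
  simp only [laurent_nil, laurent_cons, zipWith_zpow_cons, zipWith_zpow_nil, ← hz, ← hy] at h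
  rw [← sub_eq_zero]
  refine Eq.trans ?_ h
  push_cast
  field_simp
  ring

theorem relation_level_six_three_six (τ : ℍ) {z y : ℂ}
    (hz : z = etaQuotient [(3, 12), (6, -12)] τ)
    (hy : y = etaQuotient [(1, 2), (2, 2), (3, -2), (6, -2)] τ) :
    z + 64 * z⁻¹ = (y ^ 2 + 3) ^ 2 * y⁻¹ := by
  have hz0 : z ≠ 0 := hz ▸ etaQuotient_ne_zero (by decide) τ
  have hy0 : y ≠ 0 := hy ▸ etaQuotient_ne_zero (by decide) τ
  have h := laurent_eq_zero (N := 6) 4 [1, 2, 3, 6] [(1, -4), (2, 8), (3, 16), (6, -20)]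
    (gens := [[(3, 12), (6, -12)], [(1, 2), (2, 2), (3, -2), (6, -2)]])
    (R := [(1, [1, 0]), (-1, [0, 3]), (-6, [0, 1]), (-9, [0, -1]), (64, [-1, 0])])
    (by decide +kernel) τ
  simp only [laurent_nil, laurent_cons, zipWith_zpow_cons, zipWith_zpow_nil, ← hz, ← hy] at h
  rw [← sub_eq_zero]
  refine Eq.trans ?_ h
  push_cast
  field_simp
  ring

theorem relation_level_ten_one_five (τ : ℍ) {z y : ℂ}
    (hz : z = etaQuotient [(1, 6), (5, -6)] τ)
    (hy : y = etaQuotient [(1, 4), (5, 4), (2, -4), (10, -4)] τ) :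
    z + 125 * z⁻¹ + 22 = (y + 4) * (1 + 8 * y⁻¹) ^ 2 := by
  have hz0 : z ≠ 0 := hz ▸ etaQuotient_ne_zero (by decide) τ
  have hy0 : y ≠ 0 := hy ▸ etaQuotient_ne_zero (by decide) τ
  have h := laurent_eq_zero (N := 10) 6 [1, 2, 5, 10] [(1, 2), (2, 4), (5, 14), (10, -20)]
    (gens := [[(1, 6), (5, -6)], [(1, 4), (5, 4), (2, -4), (10, -4)]])
    (R := [(1, [1, 0]), (-1, [0, 1]), (2, [0, 0]), (-128, [0, -1]), (-256, [0, -2]),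
         (125, [-1, 0])])
    (by decide +kernel) τ
  simp only [laurent_nil, laurent_cons, zipWith_zpow_cons, zipWith_zpow_nil, ← hz, ← hy] at h
  rw [← sub_eq_zero]
  refine Eq.trans ?_ h
  push_cast
  field_simp
  ring

theorem relation_level_ten_two_ten (τ : ℍ) {z y : ℂ}
    (hz : z = etaQuotient [(2, 6), (10, -6)] τ)
    (hy : y = etaQuotient [(1, 4), (5, 4), (2, -4), (10, -4)] τ) :
    z + 125 * z⁻¹ + 22 = (y + 2) ^ 2 * (1 + 4 * y⁻¹) := by
  have hz0 : z ≠ 0 := hz ▸ etaQuotient_ne_zero (by decide) τ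
  have hy0 : y ≠ 0 := hy ▸ etaQuotient_ne_zero (by decide) τ
  have h := laurent_eq_zero (N := 10) 6 [1, 2, 5, 10] [(1, -2), (2, 8), (5, 10), (10, -16)]
    (gens := [[(2, 6), (10, -6)], [(1, 4), (5, 4), (2, -4), (10, -4)]])
    (R := [(1, [1, 0]), (-1, [0, 2]), (-8, [0, 1]), (2, [0, 0]), (-16, [0, -1]), (125, [-1, 0])])
    (by decide +kernel) τ
  simp only [laurent_nil, laurent_cons, zipWith_zpow_cons, zipWith_zpow_nil, ← hz, ← hy] at h
  rw [← sub_eq_zero]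
  refine Eq.trans ?_ h
  push_cast
  field_simp
  ring

theorem relation_level_twelve_add_four (τ : ℍ) {z y : ℂ}
    (hz : z = etaQuotient [(1, -2), (2, 6), (3, -2), (4, -4), (6, 6), (12, -4)] τ)
    (hy : y = etaQuotient [(1, 2), (3, 2), (4, -2), (12, -2)] τ) :
    y + 4 = z := by
  have hz0 : z ≠ 0 := hz ▸ etaQuotient_ne_zero (by decide) τ
  have hy0 : y ≠ 0 := hy ▸ etaQuotient_ne_zero (by decide) τ
  have h := laurent_eq_zero (N := 12) 2 [1, 2, 3, 4, 6, 12] [(2, -2), (4, 4), (6, 2), (12, -4)]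
    (gens := [[(1, -2), (2, 6), (3, -2), (4, -4), (6, 6), (12, -4)], [(1, 2), (3, 2), (4, -2), (12, -2)]])
    (R := [(-1, [1, 0]), (1, [0, 1]), (4, [0, 0])])
    (by decide +kernel) τ
  simp only [laurent_nil, laurent_cons, zipWith_zpow_cons, zipWith_zpow_nil, ← hz, ← hy] at h
  rw [← sub_eq_zero]
  refine Eq.trans ?_ h
  push_cast
  field_simp
  ring

/-- Treating w = y + 4 as a third generator turns division by y + 4 into a negative exponent, so the
relation stays a Laurent polynomial. -/
theorem relation_level_twelve_one_three (τ : ℍ) {z y w : ℂ}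
    (hz : z = etaQuotient [(1, 12), (3, -12)] τ)
    (hy : y = etaQuotient [(1, 2), (3, 2), (4, -2), (12, -2)] τ)
    (hw : w = etaQuotient [(1, -2), (2, 6), (3, -2), (4, -4), (6, 6), (12, -4)] τ) :
    z + 729 * z⁻¹ + 54 = (y + 8) ^ 6 / (y ^ 4 * w) := by
  have hz0 : z ≠ 0 := hz ▸ etaQuotient_ne_zero (by decide) τ
  have hy0 : y ≠ 0 := hy ▸ etaQuotient_ne_zero (by decide) τ
  have hw0 : w ≠ 0 := hw ▸ etaQuotient_ne_zero (by decide) τ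
  have h := laurent_eq_zero (N := 12) 12 [1, 2, 3, 4, 6, 12] [(1, 6), (2, -6), (3, 6), (4, 12), (6, 18), (12, -36)]
    (gens := [[(1, 12), (3, -12)], [(1, 2), (3, 2), (4, -2), (12, -2)], [(1, -2), (2, 6), (3, -2), (4, -4), (6, 6), (12, -4)]])
    (R := [(1, [1, 0, 0]), (-1, [0, 2, -1]), (-48, [0, 1, -1]), (54, [0, 0, 0]),
         (-960, [0, 0, -1]), (-10240, [0, -1, -1]), (-61440, [0, -2, -1]),
         (-196608, [0, -3, -1]), (-262144, [0, -4, -1]), (729, [-1, 0, 0])])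
    (by decide +kernel) τ
  simp only [laurent_nil, laurent_cons, zipWith_zpow_cons, zipWith_zpow_nil, ← hz, ← hy, ← hw] at h
  rw [← sub_eq_zero]
  refine Eq.trans ?_ h
  push_cast
  field_simp
  ring

theorem relation_level_twelve_two_six (τ : ℍ) {z y w : ℂ}
    (hz : z = etaQuotient [(2, 6), (6, -6)] τ)
    (hy : y = etaQuotient [(1, 2), (3, 2), (4, -2), (12, -2)] τ)
    (hw : w = etaQuotient [(1, -2), (2, 6), (3, -2), (4, -4), (6, 6), (12, -4)] τ) :
    z - 27 * z⁻¹ = (y + 2) * (y - 4) * (y + 8) / (y * w) := by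
  have hz0 : z ≠ 0 := hz ▸ etaQuotient_ne_zero (by decide) τ
  have hy0 : y ≠ 0 := hy ▸ etaQuotient_ne_zero (by decide) τ
  have hw0 : w ≠ 0 := hw ▸ etaQuotient_ne_zero (by decide) τ
  have h := laurent_eq_zero (N := 12) 6 [1, 2, 3, 4, 6, 12] [(4, 6), (6, 12), (12, -18)]
    (gens := [[(2, 6), (6, -6)], [(1, 2), (3, 2), (4, -2), (12, -2)], [(1, -2), (2, 6), (3, -2), (4, -4), (6, 6), (12, -4)]])
    (R := [(1, [1, 0, 0]), (-1, [0, 2, -1]), (-6, [0, 1, -1]), (24, [0, 0, -1]),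
         (64, [0, -1, -1]), (-27, [-1, 0, 0])])
    (by decide +kernel) τ
  simp only [laurent_nil, laurent_cons, zipWith_zpow_cons, zipWith_zpow_nil, ← hz, ← hy, ← hw] at h
  rw [← sub_eq_zero]
  refine Eq.trans ?_ h
  push_cast
  field_simp
  ring

theorem relation_level_twelve_four_twelve (τ : ℍ) {z y w : ℂ}
    (hz : z = etaQuotient [(4, 12), (12, -12)] τ)
    (hy : y = etaQuotient [(1, 2), (3, 2), (4, -2), (12, -2)] τ)
    (hw : w = etaQuotient [(1, -2), (2, 6), (3, -2), (4, -4), (6, 6), (12, -4)] τ) :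
    z + 729 * z⁻¹ + 54 = (y + 2) ^ 6 / (y * w) := by
  have hz0 : z ≠ 0 := hz ▸ etaQuotient_ne_zero (by decide) τ
  have hy0 : y ≠ 0 := hy ▸ etaQuotient_ne_zero (by decide) τ
  have hw0 : w ≠ 0 := hw ▸ etaQuotient_ne_zero (by decide) τ
  have h := laurent_eq_zero (N := 12) 12 [1, 2, 3, 4, 6, 12] [(2, -6), (4, 18), (6, 18), (12, -30)]
    (gens := [[(4, 12), (12, -12)], [(1, 2), (3, 2), (4, -2), (12, -2)], [(1, -2), (2, 6), (3, -2), (4, -4), (6, 6), (12, -4)]])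
    (R := [(1, [1, 0, 0]), (-1, [0, 5, -1]), (-12, [0, 4, -1]), (-60, [0, 3, -1]),
         (-160, [0, 2, -1]), (-240, [0, 1, -1]), (54, [0, 0, 0]), (-192, [0, 0, -1]),
         (-64, [0, -1, -1]), (729, [-1, 0, 0])])
    (by decide +kernel) τ
  simp only [laurent_nil, laurent_cons, zipWith_zpow_cons, zipWith_zpow_nil, ← hz, ← hy, ← hw] at h
  rw [← sub_eq_zero]
  refine Eq.trans ?_ h
  push_cast
  field_simp
  ring

theorem relation_level_fifteen_one_five (τ : ℍ) {z y : ℂ}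
    (hz : z = etaQuotient [(1, 6), (5, -6)] τ)
    (hy : y = etaQuotient [(1, 2), (5, 2), (3, -2), (15, -2)] τ) :
    z + 125 * z⁻¹ + 22 = (y + 9 + 27 * y⁻¹) ^ 2 * y⁻¹ := by
  have hz0 : z ≠ 0 := hz ▸ etaQuotient_ne_zero (by decide) τ
  have hy0 : y ≠ 0 := hy ▸ etaQuotient_ne_zero (by decide) τ
  have h := laurent_eq_zero (N := 15) 10 [1, 3, 5, 15] [(1, 2), (3, 4), (5, 14), (15, -20)]
    (gens := [[(1, 6), (5, -6)], [(1, 2), (5, 2), (3, -2), (15, -2)]])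
    (R := [(1, [1, 0]), (-1, [0, 1]), (4, [0, 0]), (-135, [0, -1]), (-486, [0, -2]),
         (-729, [0, -3]), (125, [-1, 0])])
    (by decide +kernel) τ
  simp only [laurent_nil, laurent_cons, zipWith_zpow_cons, zipWith_zpow_nil, ← hz, ← hy] at h
  rw [← sub_eq_zero]
  refine Eq.trans ?_ h
  push_cast
  field_simp
  ring

theorem relation_level_fifteen_three_fifteen (τ : ℍ) {z y : ℂ}
    (hz : z = etaQuotient [(3, 6), (15, -6)] τ)
    (hy : y = etaQuotient [(1, 2), (5, 2), (3, -2), (15, -2)] τ) :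
    z + 125 * z⁻¹ + 22 = (y + 3 + 3 * y⁻¹) ^ 2 * y := by
  have hz0 : z ≠ 0 := hz ▸ etaQuotient_ne_zero (by decide) τ
  have hy0 : y ≠ 0 := hy ▸ etaQuotient_ne_zero (by decide) τ
  have h := laurent_eq_zero (N := 15) 10 [1, 3, 5, 15] [(1, -2), (3, 8), (5, 10), (15, -16)]
    (gens := [[(3, 6), (15, -6)], [(1, 2), (5, 2), (3, -2), (15, -2)]])
    (R := [(1, [1, 0]), (-1, [0, 3]), (-6, [0, 2]), (-15, [0, 1]), (4, [0, 0]), (-9, [0, -1]),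
         (125, [-1, 0])])
    (by decide +kernel) τ
  simp only [laurent_nil, laurent_cons, zipWith_zpow_cons, zipWith_zpow_nil, ← hz, ← hy] at h
  rw [← sub_eq_zero]
  refine Eq.trans ?_ h
  push_cast
  field_simp
  ring

/-- Here z is odd and y is even, so F₂ is -F₁ with z replaced by -z. Both y and z start with q⁻¹, so
F₂/z tends to 2. -/
theorem relation_level_nine (τ : ℍ) {z y : ℂ}
    (hz : z = etaQuotient [(1, 3), (9, -3)] τ)
    (hy : y = etaQuotient [(3, 12), (1, -6), (9, -6)] τ) :
    z + 9 + 27 * z⁻¹ = y := by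
  have hz0 : z ≠ 0 := hz ▸ etaQuotient_ne_zero (by decide) τ
  have hy0 : y ≠ 0 := hy ▸ etaQuotient_ne_zero (by decide) τ
  have h := laurent_eq_zero_of_mul (L := [1, 3, 9])
    (gens := [[(1, 3), (9, -3)], [(3, 12), (1, -6), (9, -6)]])
    (R₁ := [(1, [1, 0]), (-1, [0, 1]), (9, [0, 0]), (27, [-1, 0])])
    (R₂ := [(1, [1, 0]), (1, [0, 1]), (-9, [0, 0]), (27, [-1, 0])])
    (by decide) 0 [(1, -3), (9, 3)] 2 (by decide +kernel) (fun τ => ?_) τ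
  · simp only [laurent_nil, laurent_cons, zipWith_zpow_cons, zipWith_zpow_nil, ← hz, ← hy] at h
    rw [← sub_eq_zero, ← mul_right_inj' (pow_ne_zero 0 hy0), mul_zero]
    refine Eq.trans ?_ h
    push_cast
    field_simp
    ring
  -- The product is (z + 27/z)² - (y - 9)², which only involves z².
  · have h := laurent_eq_zero (N := 9) 4 [1, 3, 9] [(1, 6), (9, -6)]
      (gens := [[(1, 3), (9, -3)], [(3, 12), (1, -6), (9, -6)]])
      (R := [(1, [2, 0]), (-1, [0, 2]), (18, [0, 1]), (-27, [0, 0]), (729, [-2, 0])])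
      (by decide +kernel) τ
    have hz0 := etaQuotient_ne_zero (l := [(1, 3), (9, -3)]) (by decide) τ
    have hy0 := etaQuotient_ne_zero (l := [(3, 12), (1, -6), (9, -6)]) (by decide) τ
    simp only [laurent_nil, laurent_cons, zipWith_zpow_cons, zipWith_zpow_nil] at h ⊢
    refine Eq.trans ?_ h
    generalize etaQuotient [(1, 3), (9, -3)] τ = z at *
    generalize etaQuotient [(3, 12), (1, -6), (9, -6)] τ = y at *
    push_cast
    field_simp
    ring

/-- Now y is odd, and F₂ is F₁ with y replaced by -y. Here F₁ is the relation times y². In F₂/y³ the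
terms y²z and y³ each contribute 1 to the limit 2. -/
theorem relation_level_fourteen_one_seven (τ : ℍ) {z y : ℂ}
    (hz : z = etaQuotient [(1, 4), (7, -4)] τ)
    (hy : y = etaQuotient [(1, 3), (7, 3), (2, -3), (14, -3)] τ) :
    z + 49 * z⁻¹ + 13 = (y + 4) ^ 3 * (y ^ 2)⁻¹ := by
  have hz0 : z ≠ 0 := hz ▸ etaQuotient_ne_zero (by decide) τ
  have hy0 : y ≠ 0 := hy ▸ etaQuotient_ne_zero (by decide) τ
  have h := laurent_eq_zero_of_mul (L := [1, 2, 7, 14])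
    (gens := [[(1, 4), (7, -4)], [(1, 3), (7, 3), (2, -3), (14, -3)]])
    (R₁ := [(1, [1, 2]), (-1, [0, 3]), (1, [0, 2]), (-48, [0, 1]), (-64, [0, 0]), (49, [-1, 2])])
    (R₂ := [(1, [1, 2]), (1, [0, 3]), (1, [0, 2]), (48, [0, 1]), (-64, [0, 0]), (49, [-1, 2])])
    (by decide) 0 [(1, -9), (2, 9), (7, -9), (14, 9)] 2 (by decide +kernel) (fun τ => ?_) τ
  · simp only [laurent_nil, laurent_cons, zipWith_zpow_cons, zipWith_zpow_nil, ← hz, ← hy] at h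
    rw [← sub_eq_zero, ← mul_right_inj' (pow_ne_zero 2 hy0), mul_zero]
    refine Eq.trans ?_ h
    push_cast
    field_simp
    ring
  · have h := laurent_eq_zero (N := 14) 12 [1, 2, 7, 14] [(1, -8), (2, 16), (7, 8), (14, -16)]
      (gens := [[(1, 4), (7, -4)], [(1, 3), (7, 3), (2, -3), (14, -3)]])
      (R := [(1, [2, 4]), (2, [1, 4]), (-128, [1, 2]), (-1, [0, 6]), (3, [0, 4]), (-2432, [0, 2]),
         (4096, [0, 0]), (98, [-1, 4]), (-6272, [-1, 2]), (2401, [-2, 4])])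
      (by decide +kernel) τ
    have hz0 := etaQuotient_ne_zero (l := [(1, 4), (7, -4)]) (by decide) τ
    have hy0 := etaQuotient_ne_zero (l := [(1, 3), (7, 3), (2, -3), (14, -3)]) (by decide) τ
    simp only [laurent_nil, laurent_cons, zipWith_zpow_cons, zipWith_zpow_nil] at h ⊢
    refine Eq.trans ?_ h
    generalize etaQuotient [(1, 4), (7, -4)] τ = z at *
    generalize etaQuotient [(1, 3), (7, 3), (2, -3), (14, -3)] τ = y at *
    push_cast
    field_simp
    ring

theorem relation_level_fourteen_two_fourteen (τ : ℍ) {z y : ℂ}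
    (hz : z = etaQuotient [(2, 4), (14, -4)] τ)
    (hy : y = etaQuotient [(1, 3), (7, 3), (2, -3), (14, -3)] τ) :
    z + 49 * z⁻¹ + 13 = (y + 2) ^ 3 * y⁻¹ := by
  have hz0 : z ≠ 0 := hz ▸ etaQuotient_ne_zero (by decide) τ
  have hy0 : y ≠ 0 := hy ▸ etaQuotient_ne_zero (by decide) τ
  have h := laurent_eq_zero_of_mul (L := [1, 2, 7, 14])
    (gens := [[(2, 4), (14, -4)], [(1, 3), (7, 3), (2, -3), (14, -3)]])
    (R₁ := [(1, [1, 1]), (-1, [0, 3]), (-6, [0, 2]), (1, [0, 1]), (-8, [0, 0]), (49, [-1, 1])])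
    (R₂ := [(1, [1, 1]), (-1, [0, 3]), (6, [0, 2]), (1, [0, 1]), (8, [0, 0]), (49, [-1, 1])])
    -- In F₂/y² the simple poles of z/y and -y cancel. Their constant terms give 3 + 3, and 6y²
    -- gives the remaining 6.
    (by decide) 1 [(1, -6), (2, 6), (7, -6), (14, 6)] 12 (by decide +kernel) (fun τ => ?_) τ
  · simp only [laurent_nil, laurent_cons, zipWith_zpow_cons, zipWith_zpow_nil, ← hz, ← hy] at h
    rw [← sub_eq_zero, ← mul_right_inj' (pow_ne_zero 1 hy0), mul_zero]
    refine Eq.trans ?_ h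
    push_cast
    field_simp
    ring
  · have h := laurent_eq_zero (N := 14) 12 [1, 2, 7, 14] [(1, -8), (2, 16), (7, 8), (14, -16)]
      (gens := [[(2, 4), (14, -4)], [(1, 3), (7, 3), (2, -3), (14, -3)]])
      (R := [(1, [2, 2]), (-2, [1, 4]), (2, [1, 2]), (1, [0, 6]), (-38, [0, 4]), (3, [0, 2]),
         (-64, [0, 0]), (-98, [-1, 4]), (98, [-1, 2]), (2401, [-2, 2])])
      (by decide +kernel) τ
    have hz0 := etaQuotient_ne_zero (l := [(2, 4), (14, -4)]) (by decide) τ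
    have hy0 := etaQuotient_ne_zero (l := [(1, 3), (7, 3), (2, -3), (14, -3)]) (by decide) τ
    simp only [laurent_nil, laurent_cons, zipWith_zpow_cons, zipWith_zpow_nil] at h ⊢
    refine Eq.trans ?_ h
    generalize etaQuotient [(2, 4), (14, -4)] τ = z at *
    generalize etaQuotient [(1, 3), (7, 3), (2, -3), (14, -3)] τ = y at *
    push_cast
    field_simp
    ring

end EtaQuotient

/-! ### Assembly -/

open EtaQuotient

theorem lemma5p2 (τ : ℍ) :
    -- level 4
    (let y := etaQuotient [(2, 24), (1, -12), (4, -12)] τ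
     let z := etaQuotient [(1, 4), (4, -4)] τ
     z + 16 * z⁻¹ = y) ∧
    -- level 9
    (let y := etaQuotient [(3, 12), (1, -6), (9, -6)] τ
     let z := etaQuotient [(1, 3), (9, -3)] τ
     z + 9 + 27 * z⁻¹ = y) ∧
    -- level 8
    (let y := etaQuotient [(1, 4), (4, 2), (2, -2), (8, -4)] τ
     let z₁ := etaQuotient [(1, 24), (2, -24)] τ
     let z₂ := etaQuotient [(2, 12), (4, -12)] τ
     y + 4 ≠ 0 ∧ y + 8 ≠ 0 ∧
     z₁ = y ^ 4 / ((y + 4) * (y + 8) ^ 2) ∧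
     z₂ = y * (y + 8) / (y + 4)) ∧
    -- level 6, first family
    (let y := etaQuotient [(1, 6), (3, 6), (2, -6), (6, -6)] τ
     let z₁ := etaQuotient [(1, 12), (3, -12)] τ
     let z₂ := etaQuotient [(2, 12), (6, -12)] τ
     z₁ + 729 * z₁⁻¹ + 54 = (y + 16) ^ 3 * (y ^ 2)⁻¹ ∧
     z₂ + 729 * z₂⁻¹ + 54 = (y + 4) ^ 3 * y⁻¹) ∧
    -- level 6, second family
    (let y := etaQuotient [(1, 2), (2, 2), (3, -2), (6, -2)] τ
     let z₁ := etaQuotient [(1, 12), (2, -12)] τ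
     let z₂ := etaQuotient [(3, 12), (6, -12)] τ
     z₁ + 64 * z₁⁻¹ = (y ^ 2 + 27) ^ 2 * (y ^ 3)⁻¹ ∧
     z₂ + 64 * z₂⁻¹ = (y ^ 2 + 3) ^ 2 * y⁻¹) ∧
    -- level 10
    (let y := etaQuotient [(1, 4), (5, 4), (2, -4), (10, -4)] τ
     let z₁ := etaQuotient [(1, 6), (5, -6)] τ
     let z₂ := etaQuotient [(2, 6), (10, -6)] τ
     z₁ + 125 * z₁⁻¹ + 22 = (y + 4) * (1 + 8 * y⁻¹) ^ 2 ∧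
     z₂ + 125 * z₂⁻¹ + 22 = (y + 2) ^ 2 * (1 + 4 * y⁻¹)) ∧
    -- level 12
    (let y := etaQuotient [(1, 2), (3, 2), (4, -2), (12, -2)] τ
     let z₁ := etaQuotient [(1, 12), (3, -12)] τ
     let z₂ := etaQuotient [(2, 6), (6, -6)] τ
     let z₄ := etaQuotient [(4, 12), (12, -12)] τ
     y + 4 ≠ 0 ∧
     z₁ + 729 * z₁⁻¹ + 54 = (y + 8) ^ 6 / (y ^ 4 * (y + 4)) ∧
     z₂ - 27 * z₂⁻¹ = (y + 2) * (y - 4) * (y + 8) / (y * (y + 4)) ∧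
     z₄ + 729 * z₄⁻¹ + 54 = (y + 2) ^ 6 / (y * (y + 4))) ∧
    -- level 14
    (let y := etaQuotient [(1, 3), (7, 3), (2, -3), (14, -3)] τ
     let z₁ := etaQuotient [(1, 4), (7, -4)] τ
     let z₂ := etaQuotient [(2, 4), (14, -4)] τ
     z₁ + 49 * z₁⁻¹ + 13 = (y + 4) ^ 3 * (y ^ 2)⁻¹ ∧
     z₂ + 49 * z₂⁻¹ + 13 = (y + 2) ^ 3 * y⁻¹) ∧
    -- level 15
    (let y := etaQuotient [(1, 2), (5, 2), (3, -2), (15, -2)] τ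
     let z₁ := etaQuotient [(1, 6), (5, -6)] τ
     let z₂ := etaQuotient [(3, 6), (15, -6)] τ
     z₁ + 125 * z₁⁻¹ + 22 = (y + 9 + 27 * y⁻¹) ^ 2 * y⁻¹ ∧
     z₂ + 125 * z₂⁻¹ + 22 = (y + 3 + 3 * y⁻¹) ^ 2 * y) := by
  have h4 := relation_level_eight_add_four τ rfl rfl
  have h8 := relation_level_eight_add_eight τ rfl rfl
  have h12 := relation_level_twelve_add_four τ rfl rfl
  refine ⟨relation_level_four τ rfl rfl, relation_level_nine τ rfl rfl, ⟨?_, ?_, ?_, ?_⟩,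
    ⟨relation_level_six_one_three τ rfl rfl, relation_level_six_two_six τ rfl rfl⟩,
    ⟨relation_level_six_one_two τ rfl rfl, relation_level_six_three_six τ rfl rfl⟩,
    ⟨relation_level_ten_one_five τ rfl rfl, relation_level_ten_two_ten τ rfl rfl⟩,
    ⟨?_, ?_, ?_, ?_⟩,
    ⟨relation_level_fourteen_one_seven τ rfl rfl, relation_level_fourteen_two_fourteen τ rfl rfl⟩,
    ⟨relation_level_fifteen_one_five τ rfl rfl, relation_level_fifteen_three_fifteen τ rfl rfl⟩⟩
  · rw [h4]
    exact etaQuotient_ne_zero (by decide) τ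
  · rw [h8]
    exact etaQuotient_ne_zero (by decide) τ
  -- With y + 4 and y + 8 replaced by η-quotients, both level 8 formulas only compare exponents of
  -- the η(δτ).
  · rw [h4, h8]
    have h1 := eta_smul_ne_zero (δ := 1) (by decide) τ
    have h2 := eta_smul_ne_zero (δ := 2) (by decide) τ
    have h3 := eta_smul_ne_zero (δ := 4) (by decide) τ
    have h5 := eta_smul_ne_zero (δ := 8) (by decide) τ
    simp only [etaQuotient_cons, etaQuotient_nil]
    generalize ModularForm.eta ((1 : ℕ) * τ : ℂ) = e1 at *
    generalize ModularForm.eta ((2 : ℕ) * τ : ℂ) = e2 at *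
    generalize ModularForm.eta ((4 : ℕ) * τ : ℂ) = e4 at *
    generalize ModularForm.eta ((8 : ℕ) * τ : ℂ) = e8 at *
    field_simp
  · rw [h4, h8]
    have h1 := eta_smul_ne_zero (δ := 1) (by decide) τ
    have h2 := eta_smul_ne_zero (δ := 2) (by decide) τ
    have h3 := eta_smul_ne_zero (δ := 4) (by decide) τ
    have h5 := eta_smul_ne_zero (δ := 8) (by decide) τ
    simp only [etaQuotient_cons, etaQuotient_nil]
    generalize ModularForm.eta ((1 : ℕ) * τ : ℂ) = e1 at *
    generalize ModularForm.eta ((2 : ℕ) * τ : ℂ) = e2 at *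
    generalize ModularForm.eta ((4 : ℕ) * τ : ℂ) = e4 at *
    generalize ModularForm.eta ((8 : ℕ) * τ : ℂ) = e8 at *
    field_simp
  · rw [h12]
    exact etaQuotient_ne_zero (by decide) τ
  · rw [h12]
    exact relation_level_twelve_one_three τ rfl rfl rfl
  · rw [h12]
    exact relation_level_twelve_two_six τ rfl rfl rfl
  · rw [h12]
    exact relation_level_twelve_four_twelve τ rfl rfl rfl
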